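/- Let $N\ge 1$ be an integer, $0<\lambda<1$, and let $T\ge 0$ be a real threshold. Consider $N$ queues, namely the uplinks of the first layer of a fat-tree network. Packets arrive in a Poisson process of rate $N\lambda$. Each arriving packet has a default uplink $h$, uniformly distributed on the $N$ uplinks, and an alternative uplink $r$ which, given $h$, is uniformly distributed on a nonempty set $A(h)$ of uplinks (for instance all uplinks, all uplinks other than $h$, or the other uplinks of the switch to which $h$ belongs). If $Q_i$ denotes the number of packets at uplink $i$, the packet joins $r$ if $Q_r<Q_h-T$, and joins $h$ otherwise (threshold-based two-choice). Each uplink serves its packets one at a time, with independent exponential service times of parameter $1$. The queue-length vector $\mathbf Q(t)=(Q_1(t),\dots,Q_N(t))$ is then a continuous-time Markov chain on $\{0,1,2,\dots\}^N$. Its transition rates are $q\mapsto q+e_i$ at rate $N\lambda\,p_i(q)$, where $p_i(q)$ is the probability that a packet arriving in state $q$ joins uplink $i$, and $q\mapsto q-e_i$ at rate $1$ if $q_i>0$. **Theorem 2.** The chain $(\mathbf Q(t))$ is irreducible, nonexplosive and positive recurrent. It has exactly one equilibrium (stationary) distribution, and for the chain started from this distribution, $$E\Big[\frac1N\sum_{i=1}^N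 Q_i(t)\Big]<\frac1{1-\lambda}\qquad\text{for all } t\ge 0 ,$$ whatever the values of $N$, $T$ and the sets $A(h)$. -/

import Mathlib

open MeasureTheory ProbabilityTheory
open scoped NNReal ENNReal

noncomputable section

/-- The exponential law with parameter `1` is a probability measure. -/
instance instIsProbabilityMeasureExpOne : IsProbabilityMeasure (expMeasure 1) :=
  isProbabilityMeasure_expMeasure one_pos

/-- The off-diagonal part of a (stable, conservative) transition rate matrix on `S`:
`rate x y` is the rate of jumps from `x` to `y ≠ x`, and the total rate out of every state is
finite. -/
structure RateMatrix (S : Type*) where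
  rate : S → S → ℝ≥0
  rate_self : ∀ x, rate x x = 0
  summable_rate : ∀ x, Summable (rate x)

namespace RateMatrix

variable {S : Type*}

/-- Total rate out of the state `x`. -/
def exitRate (Q : RateMatrix S) (x : S) : ℝ≥0 := ∑' y, Q.rate x y

theorem tsum_rate_eq (Q : RateMatrix S) (x : S) :
    (∑' y, (Q.rate x y : ℝ≥0∞)) = (Q.exitRate x : ℝ≥0∞) :=
  (ENNReal.coe_tsum (Q.summable_rate x)).symm

open Classical in
/-- Law of the next state visited after `x`: proportional to the rates out of `x`. A state with
exit rate `0` is absorbing. -/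
def jumpPMF (Q : RateMatrix S) (x : S) : PMF S :=
  if h : Q.exitRate x = 0 then PMF.pure x
  else PMF.normalize (fun y => (Q.rate x y : ℝ≥0∞))
    (by rw [Q.tsum_rate_eq]; exact_mod_cast h)
    (by rw [Q.tsum_rate_eq]; exact ENNReal.coe_ne_top)

variable [Countable S] [MeasurableSpace S] [DiscreteMeasurableSpace S]

/-- Transition kernel of the jump chain. -/
def jumpKernel (Q : RateMatrix S) : Kernel S S where
  toFun x := (Q.jumpPMF x).toMeasure
  measurable' := Measurable.of_discrete

instance (Q : RateMatrix S) : IsMarkovKernel Q.jumpKernel :=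
  ⟨fun x => PMF.toMeasure.isProbabilityMeasure (Q.jumpPMF x)⟩

/-- Transition kernel of the jump chain as a function of the whole past: only the present state
matters. -/
def pastKernel (Q : RateMatrix S) (n : ℕ) : Kernel ((i : Finset.Iic n) → S) S :=
  Q.jumpKernel.comap (fun past => past ⟨n, Finset.mem_Iic.2 le_rfl⟩) (measurable_pi_apply _)

instance (Q : RateMatrix S) (n : ℕ) : IsMarkovKernel (Q.pastKernel n) := by
  unfold pastKernel; infer_instance

/-- Sample space of the jump chain/holding time construction: the sequence of visited states and
a sequence of standard exponential clocks. -/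
abbrev Path (S : Type*) : Type _ := (ℕ → S) × (ℕ → ℝ)

/-- Law, on the sample space, of the continuous-time Markov chain with rates `Q` and initial
distribution `μ`: the visited states form the discrete-time Markov chain with initial
distribution `μ` and kernel `jumpKernel`, and the clocks are i.i.d. exponential with parameter `1`
and independent of the visited states. -/
def law (Q : RateMatrix S) (μ : Measure S) [IsProbabilityMeasure μ] : Measure (Path S) :=
  (Kernel.trajMeasure (X := fun _ => S) μ Q.pastKernel).prod
    (Measure.infinitePi fun _ : ℕ => expMeasure 1)

/-- Law of the chain started from the state `x`. -/
def lawFrom (Q : RateMatrix S) (x : S) : Measure (Path S) := Q.law (Measure.dirac x)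

/-- Holding time in the `n`-th visited state `x`: exponential with parameter the exit rate of `x`
(infinite if `x` is absorbing). -/
def holding (Q : RateMatrix S) (n : ℕ) (ω : Path S) : ℝ≥0∞ :=
  ENNReal.ofReal (ω.2 n) / (Q.exitRate (ω.1 n) : ℝ≥0∞)

/-- Time of the `n`-th jump (`jumpTime 0 = 0`). -/
def jumpTime (Q : RateMatrix S) (n : ℕ) (ω : Path S) : ℝ≥0∞ :=
  ∑ k ∈ Finset.range n, Q.holding k ω

open Classical in
/-- State of the chain at time `t`: the `n`-th visited state if
`jumpTime n ≤ t < jumpTime (n + 1)`, and `none` if the chain has exploded by time `t`. -/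
def state (Q : RateMatrix S) (t : ℝ≥0) (ω : Path S) : Option S :=
  if h : ∃ n, (t : ℝ≥0∞) < Q.jumpTime (n + 1) ω then some (ω.1 (Nat.find h)) else none

/-- First time, after the first jump, at which the chain is in the state `x`. -/
def returnTime (Q : RateMatrix S) (x : S) (ω : Path S) : ℝ≥0∞ :=
  ⨅ (t : ℝ≥0) (_ : Q.jumpTime 1 ω ≤ t) (_ : Q.state t ω = some x), (t : ℝ≥0∞)

/-- Every state can be reached from every state with positive probability. -/
def IsIrreducible (Q : RateMatrix S) : Prop :=
  ∀ x y, ∃ t : ℝ≥0, 0 < Q.lawFrom x {ω | Q.state t ω = some y}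

/-- From every initial state, almost surely there are only finitely many jumps in finite time. -/
def IsNonexplosive (Q : RateMatrix S) : Prop :=
  ∀ x, ∀ᵐ ω ∂(Q.lawFrom x), ∑' n, Q.holding n ω = ∞

/-- Every state is absorbing or has a finite expected return time. -/
def IsPositiveRecurrent (Q : RateMatrix S) : Prop :=
  ∀ x, Q.exitRate x = 0 ∨ ∫⁻ ω, Q.returnTime x ω ∂(Q.lawFrom x) < ∞

/-- `π` is an equilibrium distribution: started from `π`, the chain has the distribution `π` at
all times. -/
def IsEquilibrium (Q : RateMatrix S) (π : ProbabilityMeasure S) : Prop :=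
  ∀ (t : ℝ≥0) (y : S), Q.law (π : Measure S) {ω | Q.state t ω = some y} = (π : Measure S) {y}

end RateMatrix

namespace TTC

variable {N : ℕ}

/-- Uplink joined by a packet with default uplink `h` and random alternative `r` when the queue
lengths are `q`: the packet is redirected to `r` if and only if `q r < q h - T`. -/
def route (T : ℝ) (q : Fin N → ℕ) (h r : Fin N) : Fin N :=
  if (q r : ℝ) < (q h : ℝ) - T then r else h

/-- Probability that an arriving packet joins uplink `i` when the queue lengths are `q`: the
default uplink `h` is uniform on all `N` uplinks and, given `h`, the alternative is uniform on the
set `A h` of alternatives of `h`. -/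
def joinProb (T : ℝ) (A : Fin N → Finset (Fin N)) (q : Fin N → ℕ) (i : Fin N) : ℝ≥0 :=
  ∑ h, (N : ℝ≥0)⁻¹ * ∑ r ∈ A h, ((A h).card : ℝ≥0)⁻¹ * if route T q h r = i then 1 else 0

/-- Transition rates of the vector of queue lengths: from `q`, packets join uplink `i` at rate
`N * lam` times the probability of joining `i`, and leave each nonempty queue at rate `1`. -/
def rate (lam : ℝ≥0) (T : ℝ) (A : Fin N → Finset (Fin N)) (q q' : Fin N → ℕ) : ℝ≥0 :=
  (∑ i, if q' = Function.update q i (q i + 1) then N * lam * joinProb T A q i else 0) +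
    ∑ i, if 0 < q i ∧ q' = Function.update q i (q i - 1) then 1 else 0

theorem rate_self (lam : ℝ≥0) (T : ℝ) (A : Fin N → Finset (Fin N)) (q : Fin N → ℕ) :
    rate lam T A q q = 0 := by
  have h1 : ∀ i, q ≠ Function.update q i (q i + 1) := fun i h => by
    have := congrFun h i
    simp at this
  have h2 : ∀ i, ¬ (0 < q i ∧ q = Function.update q i (q i - 1)) := fun i h => by
    have h3 := congrFun h.2 i
    rw [Function.update_self] at h3
    have h4 := h.1
    omega
  simp only [rate, h1, h2, if_false, Finset.sum_const_zero, add_zero]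

theorem summable_rate (lam : ℝ≥0) (T : ℝ) (A : Fin N → Finset (Fin N)) (q : Fin N → ℕ) :
    Summable (rate lam T A q) := by
  refine Summable.add (summable_sum fun i _ => ?_) (summable_sum fun i _ => ?_)
  · refine summable_of_ne_finset_zero (s := {Function.update q i (q i + 1)}) fun b hb => ?_
    rw [if_neg (by simpa using hb)]
  · refine summable_of_ne_finset_zero (s := {Function.update q i (q i - 1)}) fun b hb => ?_
    rw [if_neg (fun h => hb (by simpa using h.2))]

/-- The continuous-time Markov chain of the queue lengths of `N` uplinks under threshold-based
two-choice with threshold `T`. -/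
def chain (N : ℕ) (lam : ℝ≥0) (T : ℝ) (A : Fin N → Finset (Fin N)) : RateMatrix (Fin N → ℕ) where
  rate := rate lam T A
  rate_self := rate_self lam T A
  summable_rate := summable_rate lam T A

/-- Average queue length (infinite for an exploded chain). -/
def averageQueue : Option (Fin N → ℕ) → ℝ≥0∞
  | none => ∞
  | some q => (∑ i, (q i : ℝ≥0∞)) / N

end TTC

end

set_option linter.unusedSectionVars false

/-! The Lyapunov function is the sum of squares V(q) = Σ q_i² (`energy`). Since T ≥ 0, a redirected
packet always goes to a shorter queue, so the mean length of the queue joined by an arrival is at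
most the plain average of the q_i, whatever T and A (`sum_joinProb_mul_queue_le`). Arrivals
therefore raise V at rate at most 2λ Σ q_i + Nλ, and departures change it at rate at most -2 Σ q_i +
N. Hence the drift is at most N(1+λ) - 2(1-λ) Σ q_i (`energy_drift`).

Exit rates are bounded, so the chain can be uniformized to a discrete chain. Foster's argument
(`exists_invariant_of_drift`) takes a limit of Cesàro means of the laws of that chain. The drift
inequality prevents loss of mass, and Fatou gives a limit that solves the balance equations and
satisfies 2(1-λ) E Σ q_i ≤ N(1+λ). No second moment of π is needed. The mean queue is thus at most
(1+λ)/(2(1-λ)), which is below 1/(1-λ) because λ < 1.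

It remains to pass from the balance equations to the process built from jumps and clocks.
Decomposition at the first jump gives the backward integral equation. Averaged over π, it shows that
π is preserved at all times (`isEquilibrium_of_balance`). Bounded exit rates and a divergent sum of
clocks exclude explosion. All states communicate: fill the shortest queue repeatedly up to a common
level, then let packets leave. The transition matrix at time 1 is therefore positive, which forces
uniqueness (`invariant_unique`). Positive recurrence follows from one half of Kac's formula
(`mul_tsum_meanAvoiding_le`). -/

noncomputable section

/-! ### Laws of sequences and the prepending of a first term -/

/-- Prepend a term to a sequence. -/
def seqCons {α : Type*} (a : α) (u : ℕ → α) : ℕ → α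
  | 0 => a
  | n + 1 => u n

@[simp] theorem seqCons_zero {α : Type*} (a : α) (u : ℕ → α) : seqCons a u 0 = a := rfl

@[simp] theorem seqCons_succ {α : Type*} (a : α) (u : ℕ → α) (n : ℕ) :
    seqCons a u (n + 1) = u n := rfl

theorem measurable_seqCons {α : Type*} [MeasurableSpace α] :
    Measurable (fun p : α × (ℕ → α) => seqCons p.1 p.2) := by
  refine measurable_pi_lambda _ fun n => ?_
  cases n with
  | zero => exact measurable_fst
  | succ n => exact (measurable_pi_apply n).comp measurable_snd

theorem measurable_seqCons_right {α : Type*} [MeasurableSpace α] (a : α) :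
    Measurable (seqCons a) :=
  measurable_seqCons.comp measurable_prodMk_left

/-- Finite measures on sequences of a countable space are determined by the initial cylinders. -/
theorem seq_measure_ext {S : Type*} [Countable S] [MeasurableSpace S] [DiscreteMeasurableSpace S]
    {μ ν : Measure (ℕ → S)} [IsFiniteMeasure μ]
    (h : ∀ (n : ℕ) (a : ℕ → S), μ {Y | ∀ i ≤ n, Y i = a i} = ν {Y | ∀ i ≤ n, Y i = a i}) :
    μ = ν := by
  have key : ∀ n, ν.map (Preorder.frestrictLe (π := fun _ => S) n) =
      μ.map (Preorder.frestrictLe (π := fun _ => S) n) := by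
    intro n
    refine Measure.ext_of_singleton fun b => ?_
    rw [Measure.map_apply (by fun_prop) (measurableSet_singleton b),
      Measure.map_apply (by fun_prop) (measurableSet_singleton b)]
    -- `b` lives on indices up to `n`; truncating the index by `min i n` extends it to a full
    -- sequence.
    have e : (Preorder.frestrictLe (π := fun _ => S) n) ⁻¹' {b} =
        {Y | ∀ i ≤ n, Y i = (fun i => b ⟨min i n, Finset.mem_Iic.2 (min_le_right _ _)⟩) i} := by
      ext Y
      simp only [Set.mem_preimage, Set.mem_singleton_iff, Set.mem_ofPred_eq]
      constructor
      · rintro rfl i hi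
        simp [Preorder.frestrictLe, hi]
      · intro H
        ext ⟨i, hi⟩
        have hi' := Finset.mem_Iic.1 hi
        rw [Preorder.frestrictLe_apply, H i hi']
        congr 2
        simp [hi']
    rw [e, h]
  have proj : IsProjectiveMeasureFamily (α := fun _ : ℕ => S)
      (fun I : Finset ℕ => μ.map (I.restrict (π := fun _ => S))) := by
    intro I J hJI
    rw [Measure.map_map (by fun_prop) (by fun_prop)]
    rfl
  refine IsProjectiveLimit.unique (α := fun _ : ℕ => S)
    (P := fun I : Finset ℕ => μ.map (I.restrict (π := fun _ => S)))
    (fun _ => rfl) ?_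
  rw [isProjectiveLimit_nat_iff proj]
  exact key

/-- Prepending an independent copy to an i.i.d. sequence does not change its law; both laws agree on
boxes. This supplies the clock half of the first-step decomposition. -/
theorem infinitePi_eq_map_seqCons {X : Type*} [MeasurableSpace X] (ν : Measure X)
    [IsProbabilityMeasure ν] :
    (Measure.infinitePi fun _ : ℕ => ν) =
      (ν.prod (Measure.infinitePi fun _ : ℕ => ν)).map (fun p => seqCons p.1 p.2) := by
  symm
  refine Measure.eq_infinitePi _ fun s t ht => ?_
  classical
  rw [Measure.map_apply measurable_seqCons (.pi s.countable_toSet fun i _ => ht i)]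
  -- Padding with `univ` turns a box over an arbitrary finite set of indices into one over an
  -- initial segment, where index 0 can be split off.
  let t' : ℕ → Set X := fun i => if i ∈ s then t i else Set.univ
  have ht' : ∀ i, MeasurableSet (t' i) := fun i => by
    dsimp [t']; split_ifs; exacts [ht i, .univ]
  obtain ⟨n, hn⟩ : ∃ n, s ⊆ Finset.range (n + 1) :=
    ⟨s.sup id, fun i hi => Finset.mem_range.2 (Nat.lt_succ_of_le (Finset.le_sup (f := id) hi))⟩
  have e : (fun p : X × (ℕ → X) => seqCons p.1 p.2) ⁻¹' ((s : Set ℕ).pi t) =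
      t' 0 ×ˢ ((Finset.range n : Set ℕ).pi fun i => t' (i + 1)) := by
    ext ⟨x, u⟩
    simp only [Set.mem_preimage, Set.mem_pi, Set.mem_prod, t']
    constructor
    · intro H
      refine ⟨?_, fun i _ => ?_⟩
      · split_ifs with h0
        · exact H 0 h0
        · trivial
      · split_ifs with h0
        · exact H (i + 1) h0
        · trivial
    · rintro ⟨H0, H⟩ i hi
      cases i with
      | zero => simpa [Finset.mem_coe.1 hi] using H0
      | succ i =>
        have := H i (by have := hn hi; simp at this ⊢; omega)
        simpa [Finset.mem_coe.1 hi] using this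
  rw [e, Measure.prod_prod, Measure.infinitePi_pi _ (fun i _ => ht' (i + 1))]
  have e2 : ∏ i ∈ s, ν (t i) = ∏ i ∈ Finset.range (n + 1), ν (t' i) := by
    rw [← Finset.prod_subset hn]
    · exact Finset.prod_congr rfl fun i hi => by simp [t', hi]
    · intro i _ hi
      simp [t', hi]
  rw [e2, Finset.prod_range_succ', mul_comm]

/-! ### First-step decomposition of the jump chain and of the continuous-time chain -/

namespace RateMatrix

variable {S : Type*} [Countable S] [MeasurableSpace S] [DiscreteMeasurableSpace S]

/-- Law of the jump chain. -/
abbrev jumpLaw (Q : RateMatrix S) (μ : Measure S) [IsProbabilityMeasure μ] : Measure (ℕ → S) :=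
  Kernel.trajMeasure (X := fun _ => S) μ Q.pastKernel

theorem measurableSet_cylinder (n : ℕ) (a : ℕ → S) :
    MeasurableSet {Y : ℕ → S | ∀ i ≤ n, Y i = a i} := by
  have : {Y : ℕ → S | ∀ i ≤ n, Y i = a i} = ⋂ i, ⋂ (_ : i ≤ n), (fun Y => Y i) ⁻¹' {a i} := by
    ext; simp
  rw [this]
  exact .iInter fun i => .iInter fun _ => measurable_pi_apply i (measurableSet_singleton _)

theorem lintegral_jumpLaw (Q : RateMatrix S) (μ : Measure S) [IsProbabilityMeasure μ]
    {f : (ℕ → S) → ℝ≥0∞} (hf : Measurable f) :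
    ∫⁻ Y, f Y ∂Q.jumpLaw μ = ∫⁻ x, ∫⁻ Y, f Y ∂Q.jumpLaw (Measure.dirac x) ∂μ := by
  have h1 : ∀ (μ : Measure S) [IsProbabilityMeasure μ], ∫⁻ Y, f Y ∂Q.jumpLaw μ =
      ∫⁻ x, ∫⁻ Y, f Y ∂(Kernel.traj (X := fun _ => S) Q.pastKernel 0
        ((MeasurableEquiv.piUnique fun _ : Finset.Iic 0 => S).symm x)) ∂μ := by
    intro μ _
    unfold jumpLaw Kernel.trajMeasure
    rw [Measure.lintegral_bind (Kernel.aemeasurable _) hf.aemeasurable, lintegral_map]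
    · exact hf.lintegral_kernel
    · fun_prop
  rw [h1 μ]
  refine lintegral_congr fun x => ?_
  rw [h1 (Measure.dirac x), lintegral_dirac]

/-- By induction: the law up to index n + 1 is the law up to index n composed with `pastKernel n`,
which sees only the n-th state. Through `seq_measure_ext` these values determine the whole law. -/
theorem jumpLaw_cylinder (Q : RateMatrix S) (μ : Measure S) [IsProbabilityMeasure μ] (n : ℕ)
    (a : ℕ → S) : Q.jumpLaw μ {Y | ∀ i ≤ n, Y i = a i} =
      μ {a 0} * ∏ i ∈ Finset.range n, Q.jumpPMF (a i) (a (i + 1)) := by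
  induction n with
  | zero =>
    have hm : Measurable (fun z : (i : Finset.Iic 0) → S => z ⟨0, Finset.mem_Iic.2 le_rfl⟩) :=
      measurable_pi_apply _
    have h : (Q.jumpLaw μ).map (fun Y => Y 0) = μ := by
      have e : (fun Y : ℕ → S => Y 0) =
          (fun z : (i : Finset.Iic 0) → S => z ⟨0, Finset.mem_Iic.2 le_rfl⟩) ∘
            (Preorder.frestrictLe (π := fun _ => S) 0) := rfl
      rw [e, ← Measure.map_map hm (by fun_prop)]
      unfold jumpLaw Kernel.trajMeasure
      rw [Measure.map_comp _ _ (by fun_prop), Kernel.traj_map_frestrictLe,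
        Kernel.partialTraj_self, Measure.id_comp, Measure.map_map hm (by fun_prop)]
      exact Measure.map_id
    have e : {Y : ℕ → S | ∀ i ≤ 0, Y i = a i} = (fun Y => Y 0) ⁻¹' {a 0} := by
      ext Y; simp
    rw [e, ← Measure.map_apply (measurable_pi_apply 0) (measurableSet_singleton _), h]
    simp
  | succ n ih =>
    have h := Kernel.map_frestrictLe_trajMeasure_compProd_eq_map_trajMeasure
      (X := fun _ => S) (μ₀ := μ) (κ := Q.pastKernel) (a := n)
    let b : (i : Finset.Iic n) → S := fun i => a i
    have hb : (Preorder.frestrictLe (π := fun _ => S) n) ⁻¹' {b} =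
        {Y | ∀ i ≤ n, Y i = a i} := by
      ext Y
      simp only [Set.mem_preimage, Set.mem_singleton_iff, Set.mem_ofPred_eq, b]
      constructor
      · intro H i hi
        exact congrFun H ⟨i, Finset.mem_Iic.2 hi⟩
      · intro H
        ext ⟨i, hi⟩
        exact H i (Finset.mem_Iic.1 hi)
    have e : {Y : ℕ → S | ∀ i ≤ n + 1, Y i = a i} =
        (fun Y => (Preorder.frestrictLe (π := fun _ => S) n Y, Y (n + 1))) ⁻¹'
          ({b} ×ˢ {a (n + 1)}) := by
      ext Y
      have := Set.ext_iff.1 hb Y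
      simp only [Set.mem_preimage, Set.mem_prod, Set.mem_ofPred_eq, Set.mem_singleton_iff] at this ⊢
      rw [this]
      constructor
      · intro H
        exact ⟨fun i hi => H i (by omega), H _ le_rfl⟩
      · rintro ⟨H, H'⟩ i hi
        rcases Nat.lt_or_ge n i with h | h
        · obtain rfl : i = n + 1 := by omega
          exact H'
        · exact H i h
    have hms : MeasurableSet (({b} : Set ((i : Finset.Iic n) → S)) ×ˢ ({a (n + 1)} : Set S)) :=
      (measurableSet_singleton _).prod (measurableSet_singleton _)
    rw [e, ← Measure.map_apply (by fun_prop) hms, ← h,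
      Measure.compProd_apply_prod (measurableSet_singleton _) (measurableSet_singleton _),
      lintegral_singleton, Measure.map_apply (by fun_prop) (measurableSet_singleton _), hb, ih,
      Finset.prod_range_succ]
    have : Q.pastKernel n b {a (n + 1)} = Q.jumpPMF (a n) (a (n + 1)) :=
      PMF.toMeasure_apply_singleton _ _ (measurableSet_singleton _)
    rw [this]
    ring

/-- Markov property at the first step: both sides give every cylinder the same product of transition
probabilities. -/
theorem jumpLaw_dirac (Q : RateMatrix S) (x : S) :
    Q.jumpLaw (Measure.dirac x) = (Q.jumpLaw (Q.jumpKernel x)).map (seqCons x) := by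
  refine seq_measure_ext fun n a => ?_
  rw [jumpLaw_cylinder, Measure.map_apply (measurable_seqCons_right x) (measurableSet_cylinder n a)]
  by_cases hx : x = a 0
  · cases n with
    | zero =>
      have : seqCons x ⁻¹' {Y | ∀ i ≤ 0, Y i = a i} = Set.univ := by
        ext Y; simp [hx]
      rw [this]
      simp [hx]
    | succ n =>
      have : seqCons x ⁻¹' {Y | ∀ i ≤ n + 1, Y i = a i} =
          {Y | ∀ i ≤ n, Y i = (fun i => a (i + 1)) i} := by
        ext Y
        simp only [Set.mem_preimage, Set.mem_ofPred_eq]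
        constructor
        · intro H i hi
          exact H (i + 1) (by omega)
        · intro H i hi
          cases i with
          | zero => exact hx
          | succ i => exact H i (by omega)
      rw [this, jumpLaw_cylinder, Finset.prod_range_succ']
      have : Q.jumpKernel x {a 1} = Q.jumpPMF (a 0) (a 1) := by
        rw [← hx]; exact PMF.toMeasure_apply_singleton _ _ (measurableSet_singleton _)
      simp [hx, ← this, mul_comm]
  · have : seqCons x ⁻¹' {Y | ∀ i ≤ n, Y i = a i} = ∅ := by
      ext Y
      simp only [Set.mem_preimage, Set.mem_ofPred_eq, Set.mem_empty_iff_false, iff_false]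
      exact fun H => hx (H 0 (Nat.zero_le _))
    rw [this]
    simp [hx]

theorem lintegral_jumpKernel (Q : RateMatrix S) (x : S) (f : S → ℝ≥0∞) :
    ∫⁻ z, f z ∂Q.jumpKernel x = ∑' z, Q.jumpPMF x z * f z := by
  rw [lintegral_countable']
  refine tsum_congr fun z => ?_
  have : Q.jumpKernel x {z} = Q.jumpPMF x z :=
    PMF.toMeasure_apply_singleton _ _ (measurableSet_singleton _)
  rw [this, mul_comm]

/-- First-step decomposition for the jump chain. -/
theorem lintegral_jumpLaw_dirac (Q : RateMatrix S) (x : S) {f : (ℕ → S) → ℝ≥0∞}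
    (hf : Measurable f) : ∫⁻ Y, f Y ∂Q.jumpLaw (Measure.dirac x) =
      ∑' z, Q.jumpPMF x z * ∫⁻ Y, f (seqCons x Y) ∂Q.jumpLaw (Measure.dirac z) := by
  rw [jumpLaw_dirac, lintegral_map hf (measurable_seqCons_right x),
    lintegral_jumpLaw Q (Q.jumpKernel x) (f := fun Y => f (seqCons x Y))
      (hf.comp (measurable_seqCons_right x)), lintegral_jumpKernel]

/-- I.i.d. standard exponential clocks. -/
abbrev clockLaw : Measure (ℕ → ℝ) := Measure.infinitePi fun _ : ℕ => expMeasure 1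

theorem lintegral_law_eq (Q : RateMatrix S) (μ : Measure S) [IsProbabilityMeasure μ]
    {f : Path S → ℝ≥0∞} (hf : Measurable f) :
    ∫⁻ ω, f ω ∂Q.law μ = ∫⁻ Y, ∫⁻ ξ, f (Y, ξ) ∂clockLaw ∂Q.jumpLaw μ :=
  lintegral_prod f hf.aemeasurable

instance (Q : RateMatrix S) (μ : Measure S) [IsProbabilityMeasure μ] :
    IsProbabilityMeasure (Q.law μ) := by
  unfold law; infer_instance

instance (Q : RateMatrix S) (x : S) : IsProbabilityMeasure (Q.lawFrom x) := by
  unfold lawFrom; infer_instance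

theorem lintegral_law (Q : RateMatrix S) (μ : Measure S) [IsProbabilityMeasure μ]
    {f : Path S → ℝ≥0∞} (hf : Measurable f) :
    ∫⁻ ω, f ω ∂Q.law μ = ∑' x, μ {x} * ∫⁻ ω, f ω ∂Q.lawFrom x := by
  rw [lintegral_law_eq _ _ hf, lintegral_jumpLaw _ _ hf.lintegral_prod_right', lintegral_countable']
  refine tsum_congr fun x => ?_
  rw [lawFrom, lintegral_law_eq _ _ hf, mul_comm]

theorem law_apply (Q : RateMatrix S) (μ : Measure S) [IsProbabilityMeasure μ]
    {E : Set (Path S)} (hE : MeasurableSet E) :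
    Q.law μ E = ∑' x, μ {x} * Q.lawFrom x E := by
  have := Q.lintegral_law μ (f := E.indicator 1) (measurable_one.indicator hE)
  simpa only [lintegral_indicator_one hE] using this

/-- First-step decomposition for the continuous-time chain. -/
theorem lintegral_lawFrom (Q : RateMatrix S) (x : S) {f : Path S → ℝ≥0∞} (hf : Measurable f) :
    ∫⁻ ω, f ω ∂Q.lawFrom x =
      ∫⁻ s, ∑' z, Q.jumpPMF x z * ∫⁻ ω, f (seqCons x ω.1, seqCons s ω.2) ∂Q.lawFrom z
        ∂expMeasure 1 := by
  have hg : Measurable fun p : (ℕ → S) × (ℝ × (ℕ → ℝ)) =>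
      f (seqCons x p.1, seqCons p.2.1 p.2.2) :=
    hf.comp (((measurable_seqCons_right x).comp measurable_fst).prodMk
      (measurable_seqCons.comp measurable_snd))
  have hg' : Measurable fun p : ℝ × Path S => f (seqCons x p.2.1, seqCons p.1 p.2.2) :=
    hg.comp (measurable_snd.fst.prodMk (measurable_fst.prodMk measurable_snd.snd))
  rw [lawFrom, lintegral_law_eq _ _ hf, lintegral_jumpLaw_dirac _ _ hf.lintegral_prod_right',
    lintegral_tsum]
  · refine tsum_congr fun z => ?_
    rw [lintegral_const_mul _ (Measurable.lintegral_prod_right' hg')]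
    congr 1
    have hsw := lintegral_lintegral_swap (μ := expMeasure 1) (ν := Q.lawFrom z)
      (f := fun s ω => f (seqCons x ω.1, seqCons s ω.2)) hg'.aemeasurable
    rw [hsw, lawFrom, lintegral_law_eq _ _ hg'.lintegral_prod_left']
    refine lintegral_congr fun Y => ?_
    have h2 : Measurable fun p : ℝ × (ℕ → ℝ) => f (seqCons x Y, seqCons p.1 p.2) :=
      hg.comp measurable_prodMk_left
    have h3 : Measurable fun ξ : ℕ → ℝ => f (seqCons x Y, ξ) := hf.comp measurable_prodMk_left
    rw [← lintegral_prod_symm _ h2.aemeasurable,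
      ← lintegral_map h3 measurable_seqCons, ← infinitePi_eq_map_seqCons]
  · intro z
    exact (Measurable.lintegral_prod_right' hg').aemeasurable.const_mul _

end RateMatrix

/-! ### Exponential clocks -/

theorem lintegral_expMeasure_one {f : ℝ → ℝ≥0∞} (hf : Measurable f) :
    ∫⁻ s, f s ∂expMeasure 1 = ∫⁻ s in Set.Ioi 0, ENNReal.ofReal (Real.exp (-s)) * f s := by
  have h : expMeasure 1 = volume.withDensity (exponentialPDF 1) := rfl
  have hm : Measurable (exponentialPDF 1) :=
    (measurable_exponentialPDFReal 1).ennreal_ofReal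
  rw [h, lintegral_withDensity_eq_lintegral_mul _ hm hf,
    ← setLIntegral_eq_of_support_subset (s := Set.Ici 0)]
  · rw [setLIntegral_congr Ioi_ae_eq_Ici.symm]
    refine setLIntegral_congr_fun measurableSet_Ioi fun s hs => ?_
    simp [exponentialPDF_of_nonneg (le_of_lt hs)]
  · intro s hs
    by_contra h0
    exact hs (by simp [exponentialPDF_of_neg (not_le.1 h0)])

theorem lintegral_expMeasure_one_pos {f : ℝ → ℝ≥0∞} (hf : Measurable f) {a b : ℝ} (ha : 0 ≤ a)
    (hab : a < b) (hpos : ∀ s, a < s → s < b → f s ≠ 0) : 0 < ∫⁻ s, f s ∂expMeasure 1 := by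
  rw [lintegral_expMeasure_one hf]
  refine (setLIntegral_pos_iff (by fun_prop)).2 (lt_of_lt_of_le ?_ (measure_mono
    (s := Set.Ioo a b) fun s hs => ⟨?_, lt_of_le_of_lt ha hs.1⟩))
  · simp [hab]
  · have := hpos s hs.1 hs.2
    simp [this, Real.exp_pos]

theorem ae_expMeasure_one_pos : ∀ᵐ s ∂expMeasure 1, 0 < s := by
  have h : MeasurableSet {s : ℝ | ¬ 0 < s} := measurableSet_Ioi.compl
  rw [ae_iff, ← lintegral_indicator_one h,
    lintegral_expMeasure_one (measurable_one.indicator h)]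
  rw [setLIntegral_congr_fun (g := fun _ => 0) measurableSet_Ioi]
  · simp
  · intro s hs
    have : (0 : ℝ) < s := hs
    simp [this]

theorem lintegral_id_expMeasure_one_lt_top :
    ∫⁻ s, ENNReal.ofReal s ∂expMeasure 1 < ∞ := by
  rw [lintegral_expMeasure_one (by fun_prop)]
  have h := Real.GammaIntegral_convergent (s := 2) (by norm_num)
  have h2 := h.2
  rw [hasFiniteIntegral_iff_enorm] at h2
  refine lt_of_le_of_lt (setLIntegral_mono' measurableSet_Ioi fun s hs => ?_) h2
  have h0 : (0 : ℝ) < s := hs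
  rw [Real.enorm_eq_ofReal (by positivity), ← ENNReal.ofReal_mul (Real.exp_pos _).le]
  norm_num

namespace RateMatrix

theorem ae_clockLaw_pos : ∀ᵐ ξ ∂clockLaw, ∀ n, 0 < ξ n := by
  rw [ae_all_iff]
  intro n
  have := measurePreserving_eval_infinitePi (fun _ : ℕ => expMeasure 1) n
  exact this.quasiMeasurePreserving.ae ae_expMeasure_one_pos

/-- By the second Borel–Cantelli lemma infinitely many clocks exceed 1, so the terms do not tend to
0. -/
theorem ae_clockLaw_tsum : ∀ᵐ ξ ∂clockLaw, ∑' n, ENNReal.ofReal (ξ n) = ∞ := by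
  let s : ℕ → Set (ℕ → ℝ) := fun n => {ξ | 1 < ξ n}
  have hs : ∀ n, MeasurableSet (s n) := fun n => measurableSet_lt measurable_const (by fun_prop)
  have hind : iIndepSet s clockLaw := by
    have h := iIndepFun_infinitePi (P := fun _ : ℕ => expMeasure 1) (X := fun _ x => x)
      (fun _ => measurable_id)
    rw [iIndepSet_iff_meas_biInter hs]
    intro t
    exact h.meas_biInter (S := t) fun i _ => ⟨Set.Ioi 1, measurableSet_Ioi, rfl⟩
  have hmeas : ∀ n, clockLaw (s n) = expMeasure 1 (Set.Ioi 1) := fun n =>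
    (measurePreserving_eval_infinitePi (fun _ : ℕ => expMeasure 1) n).measure_preimage
      measurableSet_Ioi.nullMeasurableSet
  have hpos : expMeasure 1 (Set.Ioi 1) ≠ 0 := by
    have := lintegral_expMeasure_one_pos (f := (Set.Ioi (1 : ℝ)).indicator 1)
      (measurable_one.indicator measurableSet_Ioi) (a := 1) (b := 2) (by norm_num) (by norm_num)
      (fun s hs _ => by simp [hs])
    rw [lintegral_indicator_one measurableSet_Ioi] at this
    exact this.ne'
  have hlim := measure_limsup_eq_one hs hind (by
    simp only [hmeas]; exact ENNReal.tsum_const_eq_top_of_ne_zero hpos)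
  have : ∀ᵐ ξ ∂clockLaw, ξ ∈ Filter.limsup s Filter.atTop :=
    (prob_compl_eq_zero_iff (.measurableSet_limsup hs)).2 hlim
  filter_upwards [this] with ξ hξ
  rw [Filter.mem_limsup_iff_frequently_mem] at hξ
  by_contra hne
  have h0 := ENNReal.tendsto_atTop_zero_of_tsum_ne_top hne
  have h1 := h0.eventually_lt_const (u := 1) (by norm_num)
  obtain ⟨n, hn, hn'⟩ := (hξ.and_eventually h1).exists
  have : (1 : ℝ≥0∞) ≤ ENNReal.ofReal (ξ n) := by
    rw [ENNReal.one_le_ofReal]; exact le_of_lt hn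
  exact absurd hn' (not_lt.2 this)

/-! ### State at a given time, transition function, positivity and nonexplosion -/

variable {S : Type*}

theorem jumpTime_mono (Q : RateMatrix S) (ω : Path S) : Monotone fun n => Q.jumpTime n ω :=
  fun _ _ h => Finset.sum_le_sum_of_subset (Finset.range_subset_range.2 h)

theorem state_eq_some_iff (Q : RateMatrix S) (t : ℝ≥0) (ω : Path S) (y : S) :
    Q.state t ω = some y ↔ ∃ n, Q.jumpTime n ω ≤ t ∧ t < Q.jumpTime (n + 1) ω ∧ ω.1 n = y := by
  classical
  unfold state
  constructor
  · intro h
    split_ifs at h with hex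
    refine ⟨Nat.find hex, ?_, Nat.find_spec hex, by simpa using h⟩
    rcases hn : Nat.find hex with _ | n
    · simp [jumpTime]
    · exact not_lt.1 (Nat.find_min hex (m := n) (by omega))
  · rintro ⟨n, h1, h2, rfl⟩
    have hex : ∃ n, (t : ℝ≥0∞) < Q.jumpTime (n + 1) ω := ⟨n, h2⟩
    rw [dif_pos hex]
    have : Nat.find hex = n := by
      rw [Nat.find_eq_iff]
      refine ⟨h2, fun m hm => not_lt.2 ?_⟩
      exact (Q.jumpTime_mono ω (by omega : m + 1 ≤ n)).trans h1
    rw [this]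

theorem state_ne_none (Q : RateMatrix S) (t : ℝ≥0) (ω : Path S)
    (h : ∑' n, Q.holding n ω = ∞) : Q.state t ω ≠ none := by
  have h1 : ∃ n, (t : ℝ≥0∞) < Q.jumpTime (n + 1) ω := by
    by_contra! hc
    have : ∑' n, Q.holding n ω ≤ t := by
      rw [ENNReal.tsum_eq_iSup_nat]
      exact iSup_le fun n => (Q.jumpTime_mono ω n.le_succ).trans (hc n)
    rw [h] at this
    exact absurd this (by simp)
  unfold state
  rw [dif_pos h1]
  simp

theorem jumpTime_seqCons_succ (Q : RateMatrix S) (x : S) (s : ℝ) (ω : Path S) (n : ℕ) :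
    Q.jumpTime (n + 1) (seqCons x ω.1, seqCons s ω.2) =
      ENNReal.ofReal s / Q.exitRate x + Q.jumpTime n ω := by
  unfold jumpTime
  rw [Finset.sum_range_succ', add_comm]
  rfl

/-- Pathwise renewal at the first jump: before it the chain sits at `x`; from then on it is the
remaining path, with the first holding time subtracted from the clock time. -/
theorem state_seqCons (Q : RateMatrix S) (t : ℝ≥0) (x y : S) (s : ℝ) (ω : Path S) :
    Q.state t (seqCons x ω.1, seqCons s ω.2) = some y ↔
      if (t : ℝ≥0∞) < ENNReal.ofReal s / Q.exitRate x then x = y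
      else Q.state (t - (ENNReal.ofReal s / Q.exitRate x).toNNReal) ω = some y := by
  set h := ENNReal.ofReal s / Q.exitRate x with hdef
  have hJ := fun n => Q.jumpTime_seqCons_succ x s ω n
  rw [← hdef] at hJ
  rw [state_eq_some_iff]
  split_ifs with ht
  · constructor
    · rintro ⟨n, h1, h2, h3⟩
      cases n with
      | zero => exact h3
      | succ n =>
        rw [hJ] at h1
        exact absurd (lt_of_le_of_lt (le_self_add.trans h1) ht) (lt_irrefl _)
    · rintro rfl
      exact ⟨0, by simp [jumpTime], by rw [hJ]; exact ht.trans_le le_self_add, rfl⟩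
  · have ht := not_lt.1 ht
    have hfin : h ≠ ∞ := (ht.trans_lt ENNReal.coe_lt_top).ne
    have e : ((t - h.toNNReal : ℝ≥0) : ℝ≥0∞) = t - h := by
      rw [ENNReal.coe_sub, ENNReal.coe_toNNReal hfin]
    have e2 : (t : ℝ≥0∞) = h + (t - h) := (add_tsub_cancel_of_le ht).symm
    rw [state_eq_some_iff, e]
    constructor
    · rintro ⟨n, h1, h2, h3⟩
      cases n with
      | zero =>
        rw [hJ] at h2
        exact absurd (ht.trans_lt h2) (by simp [jumpTime])
      | succ n =>
        rw [hJ, e2] at h1 h2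
        exact ⟨n, (ENNReal.add_le_add_iff_left hfin).1 h1,
          (ENNReal.add_lt_add_iff_left hfin).1 h2, h3⟩
    · rintro ⟨n, h1, h2, h3⟩
      refine ⟨n + 1, ?_, ?_, h3⟩ <;> rw [hJ, e2]
      · exact (ENNReal.add_le_add_iff_left hfin).2 h1
      · exact (ENNReal.add_lt_add_iff_left hfin).2 h2

variable [Countable S] [MeasurableSpace S] [DiscreteMeasurableSpace S]

theorem measurable_holding (Q : RateMatrix S) (n : ℕ) : Measurable (Q.holding n) := by
  have h1 : Measurable fun x : S => (Q.exitRate x : ℝ≥0∞) := .of_discrete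
  have h2 : Measurable fun ω : Path S => ω.1 n := (measurable_pi_apply n).comp measurable_fst
  have h3 : Measurable fun ω : Path S => ω.2 n := (measurable_pi_apply n).comp measurable_snd
  exact h3.ennreal_ofReal.div (h1.comp h2)

theorem measurable_jumpTime (Q : RateMatrix S) (n : ℕ) : Measurable (Q.jumpTime n) :=
  Finset.measurable_fun_sum _ fun k _ => Q.measurable_holding k

theorem measurableSet_state_prod (Q : RateMatrix S) (y : S) :
    MeasurableSet {p : ℝ≥0 × Path S | Q.state p.1 p.2 = some y} := by
  have : {p : ℝ≥0 × Path S | Q.state p.1 p.2 = some y} =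
      ⋃ n, ({p | Q.jumpTime n p.2 ≤ p.1} ∩ ({p | (p.1 : ℝ≥0∞) < Q.jumpTime (n + 1) p.2} ∩
        {p | p.2.1 n = y})) := by
    ext p
    simp [state_eq_some_iff]
  rw [this]
  have hf : Measurable fun p : ℝ≥0 × Path S => (p.1 : ℝ≥0∞) := measurable_fst.coe_nnreal_ennreal
  refine .iUnion fun n => (measurableSet_le ((Q.measurable_jumpTime n).comp measurable_snd) hf).inter
    ((measurableSet_lt hf ((Q.measurable_jumpTime (n + 1)).comp measurable_snd)).inter ?_)
  have hg : Measurable fun p : ℝ≥0 × Path S => p.2.1 n :=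
    (measurable_pi_apply n).comp measurable_snd.fst
  exact hg (measurableSet_singleton y)

theorem measurableSet_state (Q : RateMatrix S) (t : ℝ≥0) (y : S) :
    MeasurableSet {ω : Path S | Q.state t ω = some y} :=
  measurable_prodMk_left (Q.measurableSet_state_prod y)

/-- Transition function. -/
def trans (Q : RateMatrix S) (t : ℝ≥0) (x y : S) : ℝ≥0∞ :=
  Q.lawFrom x {ω | Q.state t ω = some y}

theorem measurable_trans (Q : RateMatrix S) (x y : S) : Measurable fun t => Q.trans t x y :=
  measurable_measure_prodMk_left (Q.measurableSet_state_prod y)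

theorem trans_le_one (Q : RateMatrix S) (t : ℝ≥0) (x y : S) : Q.trans t x y ≤ 1 := prob_le_one

theorem law_state_eq (Q : RateMatrix S) (μ : Measure S) [IsProbabilityMeasure μ] (t : ℝ≥0) (y : S) :
    Q.law μ {ω | Q.state t ω = some y} = ∑' x, μ {x} * Q.trans t x y :=
  Q.law_apply μ (Q.measurableSet_state t y)

open Classical in
/-- Backward equation: decomposition at the first jump. -/
theorem trans_eq_lintegral (Q : RateMatrix S) (t : ℝ≥0) (x y : S) :
    Q.trans t x y = ∫⁻ s, (if (t : ℝ≥0∞) < ENNReal.ofReal s / Q.exitRate x then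
        (if x = y then 1 else 0)
      else ∑' z, Q.jumpPMF x z *
        Q.trans (t - (ENNReal.ofReal s / Q.exitRate x).toNNReal) z y) ∂expMeasure 1 := by
  have hm := Q.measurableSet_state t y
  rw [trans, ← lintegral_indicator_one hm, lintegral_lawFrom _ _ (measurable_one.indicator hm)]
  refine lintegral_congr fun s => ?_
  have h := fun ω : Path S => Q.state_seqCons t x y s ω
  split_ifs with h1 h2
  · simp only [h1, if_true] at h
    have h' := fun ω => (h ω).2 h2
    simp [Set.indicator, h', PMF.tsum_coe]
  · simp only [h1, if_true] at h
    simp [Set.indicator, h, h2]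
  · refine tsum_congr fun z => ?_
    simp only [h1, if_false] at h
    congr 1
    rw [trans, ← lintegral_indicator_one (Q.measurableSet_state _ y)]
    refine lintegral_congr fun ω => ?_
    simp [Set.indicator, h]

open Classical in
theorem measurable_trans_integrand (Q : RateMatrix S) (t : ℝ≥0) (x y : S) :
    Measurable fun s : ℝ => (if (t : ℝ≥0∞) < ENNReal.ofReal s / Q.exitRate x then
        (if x = y then 1 else 0)
      else ∑' z, Q.jumpPMF x z *
        Q.trans (t - (ENNReal.ofReal s / Q.exitRate x).toNNReal) z y : ℝ≥0∞) := by
  have h1 : Measurable fun s : ℝ => ENNReal.ofReal s / Q.exitRate x := by fun_prop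
  refine Measurable.ite (measurableSet_lt measurable_const h1) measurable_const ?_
  refine Measurable.tsum fun z => ((Q.measurable_trans z y).comp ?_).const_mul _
  exact measurable_const.sub h1.ennreal_toNNReal

theorem jumpPMF_apply (Q : RateMatrix S) {x : S} (hx : Q.exitRate x ≠ 0) (y : S) :
    Q.jumpPMF x y = Q.rate x y / Q.exitRate x := by
  rw [jumpPMF, dif_neg hx, PMF.normalize_apply, Q.tsum_rate_eq, ENNReal.div_eq_inv_mul, mul_comm]

theorem exitRate_mul_jumpPMF (Q : RateMatrix S) {x : S} (hx : Q.exitRate x ≠ 0) (y : S) :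
    Q.exitRate x * Q.jumpPMF x y = Q.rate x y := by
  rw [jumpPMF_apply Q hx, ENNReal.mul_div_cancel (by exact_mod_cast hx) ENNReal.coe_ne_top]

theorem lt_ofReal_div_iff (t : ℝ≥0) (s : ℝ) {q : ℝ≥0} (hq : q ≠ 0) :
    (t : ℝ≥0∞) < ENNReal.ofReal s / q ↔ (q : ℝ) * t < s := by
  rw [ENNReal.lt_div_iff_mul_lt (by simp [hq]) (by simp), ← ENNReal.coe_mul,
    ENNReal.lt_ofReal_iff_toReal_lt ENNReal.coe_ne_top]
  simp [mul_comm]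

/-- With positive probability the first clock outlasts `t`. -/
theorem trans_self_pos (Q : RateMatrix S) {x : S} (hx : Q.exitRate x ≠ 0) (t : ℝ≥0) :
    0 < Q.trans t x x := by
  rw [trans_eq_lintegral]
  refine lintegral_expMeasure_one_pos (Q.measurable_trans_integrand t x x)
    (a := Q.exitRate x * t) (b := Q.exitRate x * t + 1) (by positivity) (by linarith) ?_
  intro s h1 h2
  rw [if_pos ((lt_ofReal_div_iff t s hx).2 h1)]
  simp

/-- With positive probability the first jump occurs before `t` and leads to `z`, which leaves a
positive time to go from `z` to `y`. -/
theorem trans_pos_of_rate_pos (Q : RateMatrix S) {x z y : S} (hxz : Q.rate x z ≠ 0)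
    (h : ∀ u : ℝ≥0, 0 < u → 0 < Q.trans u z y) (t : ℝ≥0) (ht : 0 < t) : 0 < Q.trans t x y := by
  have hx : Q.exitRate x ≠ 0 := by
    intro h0
    have := Q.tsum_rate_eq x
    rw [h0, ENNReal.coe_zero, ENNReal.tsum_eq_zero] at this
    exact hxz (by exact_mod_cast this z)
  have hq : (0 : ℝ) < Q.exitRate x := by positivity
  rw [trans_eq_lintegral]
  refine lintegral_expMeasure_one_pos (Q.measurable_trans_integrand t x y)
    (a := 0) (b := Q.exitRate x * t) le_rfl (by positivity) ?_
  intro s h1 h2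
  have hlt : ENNReal.ofReal s / Q.exitRate x < t := by
    rw [ENNReal.div_lt_iff (by simp [hx]) (by simp), ← ENNReal.coe_mul,
      ENNReal.ofReal_lt_iff_lt_toReal h1.le ENNReal.coe_ne_top]
    simpa [mul_comm] using h2
  rw [if_neg (not_lt.2 hlt.le)]
  refine (lt_of_lt_of_le ?_ (ENNReal.le_tsum z)).ne'
  refine ENNReal.mul_pos ?_ (h _ ?_).ne'
  · rw [jumpPMF_apply Q hx]
    simp [hxz]
  · rw [tsub_pos_iff_lt]
    have := (ENNReal.toNNReal_lt_toNNReal hlt.ne_top ENNReal.coe_ne_top).2 hlt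
    simpa using this

theorem trans_pos (Q : RateMatrix S) {x y : S} (hq : ∀ x, Q.exitRate x ≠ 0)
    (h : Relation.ReflTransGen (fun x z => Q.rate x z ≠ 0) x y) (t : ℝ≥0) (ht : 0 < t) :
    0 < Q.trans t x y := by
  induction h using Relation.ReflTransGen.head_induction_on generalizing t with
  | refl => exact Q.trans_self_pos (hq _) t
  | head h1 _ ih => exact Q.trans_pos_of_rate_pos h1 ih t ht

theorem ae_law_of_ae_clockLaw (Q : RateMatrix S) (μ : Measure S) [IsProbabilityMeasure μ]
    {p : (ℕ → ℝ) → Prop} (h : ∀ᵐ ξ ∂clockLaw, p ξ) : ∀ᵐ ω ∂Q.law μ, p ω.2 :=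
  Measure.quasiMeasurePreserving_snd.ae h

/-- Each holding time is at least its clock divided by B, and the clocks have an infinite sum. -/
theorem ae_tsum_holding (Q : RateMatrix S) {B : ℝ≥0} (hB : ∀ x, Q.exitRate x ≤ B)
    (μ : Measure S) [IsProbabilityMeasure μ] :
    ∀ᵐ ω ∂Q.law μ, ∑' n, Q.holding n ω = ∞ := by
  filter_upwards [Q.ae_law_of_ae_clockLaw μ ae_clockLaw_tsum] with ω h
  have : ∑' n, ENNReal.ofReal (ω.2 n) * (B : ℝ≥0∞)⁻¹ ≤ ∑' n, Q.holding n ω := by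
    refine ENNReal.tsum_le_tsum fun n => ?_
    rw [holding, div_eq_mul_inv]
    gcongr
    exact_mod_cast hB _
  rw [ENNReal.tsum_mul_right, h, ENNReal.top_mul (by simp)] at this
  exact top_le_iff.1 this

theorem isNonexplosive_of_exitRate_le (Q : RateMatrix S) {B : ℝ≥0}
    (hB : ∀ x, Q.exitRate x ≤ B) : Q.IsNonexplosive :=
  fun x => Q.ae_tsum_holding hB (Measure.dirac x)

theorem tsum_trans (Q : RateMatrix S) (hQ : Q.IsNonexplosive) (t : ℝ≥0) (x : S) :
    ∑' y, Q.trans t x y = 1 := by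
  unfold trans
  rw [← measure_iUnion]
  · rw [← prob_compl_eq_zero_iff (.iUnion fun y => Q.measurableSet_state t y)]
    refine measure_mono_null ?_ (hQ x)
    intro ω hω h
    refine hω (Set.mem_iUnion.2 ?_)
    obtain ⟨y, hy⟩ := Option.ne_none_iff_exists'.1 (Q.state_ne_none t ω h)
    exact ⟨y, hy⟩
  · intro y z hyz
    refine Set.disjoint_left.2 fun ω h1 h2 => hyz ?_
    have h1 : Q.state t ω = some y := h1
    have h2 : Q.state t ω = some z := h2
    exact Option.some_injective _ (h1.symm.trans h2)
  · exact fun y => Q.measurableSet_state t y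

end RateMatrix

/-! ### Backward equation; balance implies equilibrium -/

namespace RateMatrix

variable {S : Type*} [Countable S] [MeasurableSpace S] [DiscreteMeasurableSpace S]

/-- The transition function as a real function of a real time. -/
def transReal (Q : RateMatrix S) (x y : S) (t : ℝ) : ℝ := (Q.trans t.toNNReal x y).toReal

/-- Mean of the transition function after one step of the jump chain. -/
def jumpTransReal (Q : RateMatrix S) (x y : S) (t : ℝ) : ℝ :=
  (∑' z, Q.jumpPMF x z * Q.trans t.toNNReal z y).toReal

theorem tsum_jumpPMF_mul_trans_le_one (Q : RateMatrix S) (x y : S) (t : ℝ≥0) :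
    ∑' z, Q.jumpPMF x z * Q.trans t z y ≤ 1 := by
  rw [← (Q.jumpPMF x).tsum_coe]
  exact ENNReal.tsum_le_tsum fun z => mul_le_of_le_one_right' (Q.trans_le_one t z y)

theorem measurable_jumpTransReal (Q : RateMatrix S) (x y : S) :
    Measurable (Q.jumpTransReal x y) :=
  (Measurable.tsum fun z =>
    ((Q.measurable_trans z y).comp measurable_real_toNNReal).const_mul _).ennreal_toReal

theorem jumpTransReal_nonneg (Q : RateMatrix S) (x y : S) (t : ℝ) : 0 ≤ Q.jumpTransReal x y t :=
  ENNReal.toReal_nonneg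

theorem jumpTransReal_le_one (Q : RateMatrix S) (x y : S) (t : ℝ) : Q.jumpTransReal x y t ≤ 1 :=
  ENNReal.toReal_le_of_le_ofReal zero_le_one
    (by simpa using Q.tsum_jumpPMF_mul_trans_le_one x y t.toNNReal)

/-- Right-hand side of the backward integral equation. -/
def backward (Q : RateMatrix S) (d : ℝ) (x y : S) (t : ℝ) : ℝ :=
  Real.exp (-(Q.exitRate x * t)) *
    (d + Q.exitRate x * ∫ u in 0..t, Real.exp (Q.exitRate x * u) * Q.jumpTransReal x y u)

theorem intervalIntegrable_exp_mul_jumpTransReal (Q : RateMatrix S) (x y : S) (c a b : ℝ) :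
    IntervalIntegrable (fun u => Real.exp (c * u) * Q.jumpTransReal x y u) volume a b := by
  refine IntervalIntegrable.continuousOn_mul ?_ (by fun_prop)
  refine (intervalIntegrable_const (c := (1 : ℝ))).mono_fun
    (Q.measurable_jumpTransReal x y).aestronglyMeasurable (.of_forall fun u => ?_)
  simp [abs_of_nonneg (Q.jumpTransReal_nonneg x y u), Q.jumpTransReal_le_one x y u]

-- The substitution u = t - s/q, with q the exit rate, in the first-jump formula. It isolates the
-- dependence on t in an exponential factor and in the upper limit of an integral, so that
-- regularity in t can be read off.
open Classical in
theorem transReal_eq_backward (Q : RateMatrix S) {x : S} (hx : Q.exitRate x ≠ 0) (y : S) {t : ℝ}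
    (ht : 0 ≤ t) : Q.transReal x y t = Q.backward (if x = y then 1 else 0) x y t := by
  set d : ℝ := if x = y then 1 else 0 with hd
  set q : ℝ := (Q.exitRate x : ℝ) with hq
  have hq0 : 0 < q := NNReal.coe_pos.2 (pos_iff_ne_zero.2 hx)
  lift t to ℝ≥0 using ht
  have hm := Q.measurable_trans_integrand t x y
  have hle := lintegral_expMeasure_one hm
  rw [← trans_eq_lintegral] at hle
  let F : ℝ → ℝ := fun s => Real.exp (-s) *
    (if q * t < s then d else Q.jumpTransReal x y (t - s / q))
  have hF : ∀ s ∈ Set.Ioi (0 : ℝ), (ENNReal.ofReal (Real.exp (-s)) *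
      (if (t : ℝ≥0∞) < ENNReal.ofReal s / Q.exitRate x then (if x = y then 1 else 0)
      else ∑' z, Q.jumpPMF x z *
        Q.trans (t - (ENNReal.ofReal s / Q.exitRate x).toNNReal) z y : ℝ≥0∞)).toReal = F s := by
    intro s hs
    have hs0 : 0 < s := hs
    rw [ENNReal.toReal_mul, ENNReal.toReal_ofReal (Real.exp_pos _).le]
    simp only [F, lt_ofReal_div_iff t s hx]
    congr 1
    split_ifs with h1 h2
    · simp [hd, h2]
    · simp [hd, h2]
    · rw [jumpTransReal]
      congr 2
      ext z
      congr 2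
      have h3 : s / q ≤ t := by rw [div_le_iff₀ hq0]; linarith
      have hsq : ((ENNReal.ofReal s / Q.exitRate x).toNNReal : ℝ) = s / q := by
        rw [ENNReal.coe_toNNReal_eq_toReal, ENNReal.toReal_div, ENNReal.toReal_ofReal hs0.le]
        simp [hq]
      apply NNReal.coe_injective
      rw [Real.coe_toNNReal _ (by linarith), NNReal.coe_sub]
      · rw [hsq]
      · rw [← NNReal.coe_le_coe, hsq]
        exact h3
  have hae : AEMeasurable (fun s => (ENNReal.ofReal (Real.exp (-s)) *
      (if (t : ℝ≥0∞) < ENNReal.ofReal s / Q.exitRate x then (if x = y then 1 else 0)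
      else ∑' z, Q.jumpPMF x z *
        Q.trans (t - (ENNReal.ofReal s / Q.exitRate x).toNNReal) z y : ℝ≥0∞)))
      (volume.restrict (Set.Ioi 0)) := by
    refine Measurable.aemeasurable ?_
    refine Measurable.mul (by fun_prop) hm
  have hne : Q.trans t x y ≠ ∞ := ((Q.trans_le_one t x y).trans_lt ENNReal.one_lt_top).ne
  have hint : IntegrableOn F (Set.Ioi 0) := by
    refine IntegrableOn.congr_fun ?_ hF measurableSet_Ioi
    exact integrable_toReal_of_lintegral_ne_top hae (by rw [← hle]; exact hne)
  have hval : Q.transReal x y t = ∫ s in Set.Ioi 0, F s := by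
    rw [transReal, Real.toNNReal_coe, hle, ← integral_toReal hae]
    · exact setIntegral_congr_fun measurableSet_Ioi hF
    · exact ae_lt_top' hae (by rw [← hle]; exact hne)
  have hsub : Set.Ioi (q * t) ⊆ Set.Ioi 0 := Set.Ioi_subset_Ioi (by positivity)
  rw [hval, ← intervalIntegral.integral_interval_add_Ioi hint (hint.mono_set hsub)]
  have h1 : ∫ s in Set.Ioi (q * t), F s = Real.exp (-(q * t)) * d := by
    rw [setIntegral_congr_fun (g := fun s => Real.exp (-s) * d) measurableSet_Ioi,
      integral_mul_const, integral_exp_neg_Ioi]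
    intro s hs
    have : q * t < s := hs
    simp [F, this]
  have h2 : ∫ s in (0 : ℝ)..(q * t), F s =
      q * ∫ u in 0..(t : ℝ), Real.exp (-(q * (t - u))) * Q.jumpTransReal x y u := by
    have := intervalIntegral.integral_comp_sub_div (a := 0) (b := q * t)
      (fun u => Real.exp (-(q * (t - u))) * Q.jumpTransReal x y u) hq0.ne' (t : ℝ)
    rw [mul_div_cancel_left₀ _ hq0.ne', sub_self, zero_div, sub_zero, smul_eq_mul] at this
    rw [← this]
    refine intervalIntegral.integral_congr fun s hs => ?_
    rw [Set.uIcc_of_le (by positivity)] at hs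
    simp only [F, if_neg (not_lt.2 hs.2)]
    congr 2
    field_simp
    ring
  rw [h1, h2, backward, ← hq, mul_add, add_comm, ← mul_assoc, mul_comm _ q, mul_assoc,
    ← intervalIntegral.integral_const_mul (Real.exp _)]
  congr 2
  refine intervalIntegral.integral_congr fun u _ => ?_
  rw [← mul_assoc, ← Real.exp_add]
  ring_nf

theorem continuous_backward (Q : RateMatrix S) (d : ℝ) (x y : S) :
    Continuous (Q.backward d x y) := by
  have := intervalIntegral.continuous_primitive
    (Q.intervalIntegrable_exp_mul_jumpTransReal x y (Q.exitRate x)) 0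
  unfold backward
  fun_prop

theorem continuous_transReal (Q : RateMatrix S) {x : S} (hx : Q.exitRate x ≠ 0) (y : S) :
    Continuous (Q.transReal x y) := by
  classical
  -- `toNNReal` sends negative times to 0, so `transReal` is constant on the negative half-line;
  -- hence `max t 0`.
  have : Q.transReal x y = fun t => Q.backward (if x = y then 1 else 0) x y (max t 0) := by
    ext t
    rw [← Q.transReal_eq_backward hx y (le_max_right t 0)]
    simp only [transReal]
    congr 2
    rcases le_total t 0 with h | h
    · simp [h, Real.toNNReal_of_nonpos h]
    · simp [h]
  rw [this]
  exact (Q.continuous_backward _ x y).comp (by fun_prop)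

theorem jumpTransReal_eq_tsum (Q : RateMatrix S) (x y : S) (t : ℝ) :
    Q.jumpTransReal x y t = ∑' z, (Q.jumpPMF x z).toReal * Q.transReal z y t := by
  rw [jumpTransReal, ENNReal.tsum_toReal_eq]
  · simp [transReal]
  · intro z
    exact ENNReal.mul_ne_top (PMF.apply_ne_top _ _)
      ((Q.trans_le_one _ z y).trans_lt ENNReal.one_lt_top).ne

/-- The series of continuous functions is dominated, uniformly in t, by the summable jump
probabilities. -/
theorem continuous_jumpTransReal (Q : RateMatrix S) (hq : ∀ x, Q.exitRate x ≠ 0) (x y : S) :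
    Continuous (Q.jumpTransReal x y) := by
  have : Q.jumpTransReal x y = fun t => ∑' z, (Q.jumpPMF x z).toReal * Q.transReal z y t :=
    funext fun t => Q.jumpTransReal_eq_tsum x y t
  rw [this]
  refine continuous_tsum (u := fun z => (Q.jumpPMF x z).toReal)
    (fun z => continuous_const.mul (Q.continuous_transReal (hq z) y))
    (ENNReal.summable_toReal (Q.jumpPMF x).tsum_coe_ne_top) fun z t => ?_
  have h0 : 0 ≤ Q.transReal z y t := ENNReal.toReal_nonneg
  have h1 : Q.transReal z y t ≤ 1 := ENNReal.toReal_le_of_le_ofReal zero_le_one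
    (by simpa using Q.trans_le_one _ z y)
  rw [Real.norm_of_nonneg (by positivity)]
  exact mul_le_of_le_one_right ENNReal.toReal_nonneg h1

/-- Kolmogorov's backward equation in differential form; continuity of `jumpTransReal` permits the
fundamental theorem of calculus. -/
theorem hasDerivAt_backward (Q : RateMatrix S) (hq : ∀ x, Q.exitRate x ≠ 0) (d : ℝ) (x y : S)
    (t : ℝ) : HasDerivAt (Q.backward d x y)
      (Q.exitRate x * Q.jumpTransReal x y t - Q.exitRate x * Q.backward d x y t) t := by
  have hc : Continuous fun u => Real.exp (Q.exitRate x * u) * Q.jumpTransReal x y u :=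
    (by fun_prop : Continuous fun u => Real.exp (Q.exitRate x * u)).mul
      (Q.continuous_jumpTransReal hq x y)
  have h1 := hc.integral_hasStrictDerivAt 0 t |>.hasDerivAt
  have h2 : HasDerivAt (fun t : ℝ => Real.exp (-(Q.exitRate x * t)))
      (Real.exp (-(Q.exitRate x * t)) * -(Q.exitRate x : ℝ)) t := by
    have := ((hasDerivAt_id t).const_mul (Q.exitRate x : ℝ)).neg.exp
    simpa using this
  have h3 := h2.mul ((h1.const_mul (Q.exitRate x : ℝ)).const_add d)
  convert! h3 using 1
  have he : Real.exp (-(Q.exitRate x * t)) * Real.exp (Q.exitRate x * t) = 1 := by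
    rw [← Real.exp_add]; simp
  simp only [backward]
  linear_combination (-(Q.exitRate x : ℝ) * Q.jumpTransReal x y t) * he

open Classical in
/-- Integrated backward equation. -/
theorem trans_add_lintegral (Q : RateMatrix S) (hq : ∀ x, Q.exitRate x ≠ 0) (x y : S) (t : ℝ≥0) :
    Q.trans t x y + ∫⁻ u in Set.Ioc 0 (t : ℝ), Q.exitRate x * Q.trans u.toNNReal x y =
      (if x = y then 1 else 0) +
        ∫⁻ u in Set.Ioc 0 (t : ℝ), ∑' z, Q.rate x z * Q.trans u.toNNReal z y := by
  set d : ℝ := if x = y then 1 else 0 with hd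
  have hcT := Q.continuous_transReal (hq x) y
  have hcJ := Q.continuous_jumpTransReal hq x y
  have hftc : ∫ u in 0..(t : ℝ), (Q.exitRate x * Q.jumpTransReal x y u -
      Q.exitRate x * Q.transReal x y u) = Q.transReal x y t - d := by
    have h0 : Q.backward d x y 0 = d := by simp [backward]
    rw [Q.transReal_eq_backward (hq x) y t.coe_nonneg, ← hd]
    have := intervalIntegral.integral_eq_sub_of_hasDerivAt (a := 0) (b := (t : ℝ))
      (fun u _ => Q.hasDerivAt_backward hq d x y u)
      (((continuous_const.mul hcJ).sub
        (continuous_const.mul (Q.continuous_backward d x y))).intervalIntegrable _ _)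
    rw [h0] at this
    refine Eq.trans (intervalIntegral.integral_congr fun u hu => ?_) this
    rw [Set.uIcc_of_le t.coe_nonneg] at hu
    simp only [Q.transReal_eq_backward (hq x) y hu.1, ← hd]
  have hconv : ∀ (g : ℝ → ℝ) (G : ℝ → ℝ≥0∞), Continuous g → (∀ u, G u ≠ ∞) →
      (∀ u, (G u).toReal = g u) →
      ∫⁻ u in Set.Ioc 0 (t : ℝ), G u = ENNReal.ofReal (∫ u in 0..(t : ℝ), g u) ∧
        0 ≤ ∫ u in 0..(t : ℝ), g u := by
    intro g G hg hG hGg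
    have hnn : ∀ u, 0 ≤ g u := fun u => hGg u ▸ ENNReal.toReal_nonneg
    rw [intervalIntegral.integral_of_le t.coe_nonneg]
    refine ⟨?_, integral_nonneg hnn⟩
    rw [ofReal_integral_eq_lintegral_ofReal hg.integrableOn_Ioc (.of_forall hnn)]
    refine lintegral_congr fun u => ?_
    rw [← hGg, ENNReal.ofReal_toReal (hG u)]
  have hfin : ∀ u z, Q.trans u z y ≠ ∞ := fun u z =>
    ((Q.trans_le_one u z y).trans_lt ENNReal.one_lt_top).ne
  have hsum : ∀ u : ℝ, ∑' z, Q.rate x z * Q.trans u.toNNReal z y =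
      Q.exitRate x * ∑' z, Q.jumpPMF x z * Q.trans u.toNNReal z y := by
    intro u
    rw [← ENNReal.tsum_mul_left]
    refine tsum_congr fun z => ?_
    rw [← mul_assoc, exitRate_mul_jumpPMF Q (hq x)]
  obtain ⟨hA, hA0⟩ := hconv (fun u => Q.exitRate x * Q.transReal x y u)
    (fun u => Q.exitRate x * Q.trans u.toNNReal x y) (continuous_const.mul hcT)
    (fun u => ENNReal.mul_ne_top ENNReal.coe_ne_top (hfin _ _))
    (fun u => by simp [transReal])
  obtain ⟨hB, hB0⟩ := hconv (fun u => Q.exitRate x * Q.jumpTransReal x y u)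
    (fun u => ∑' z, Q.rate x z * Q.trans u.toNNReal z y) (continuous_const.mul hcJ)
    (fun u => by
      rw [hsum]
      exact ENNReal.mul_ne_top ENNReal.coe_ne_top
        ((Q.tsum_jumpPMF_mul_trans_le_one x y _).trans_lt ENNReal.one_lt_top).ne)
    (fun u => by simp [hsum, jumpTransReal])
  have hT : Q.trans t x y = ENNReal.ofReal (Q.transReal x y t) := by
    rw [transReal, Real.toNNReal_coe, ENNReal.ofReal_toReal (hfin _ _)]
  have hd' : (if x = y then 1 else 0 : ℝ≥0∞) = ENNReal.ofReal d := by
    rw [hd]; split_ifs <;> simp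
  have hd0 : 0 ≤ d := by rw [hd]; split_ifs <;> simp
  have hiJ : IntervalIntegrable (fun u => Q.exitRate x * Q.jumpTransReal x y u) volume 0 t :=
    (continuous_const.mul hcJ).intervalIntegrable _ _
  have hiT : IntervalIntegrable (fun u => Q.exitRate x * Q.transReal x y u) volume 0 t :=
    (continuous_const.mul hcT).intervalIntegrable _ _
  rw [intervalIntegral.integral_sub hiJ hiT] at hftc
  have hT0 : 0 ≤ Q.transReal x y t := ENNReal.toReal_nonneg
  rw [hA, hB, hT, hd', ← ENNReal.ofReal_add hT0 hA0,
    ← ENNReal.ofReal_add hd0 hB0]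
  congr 1
  linarith

/-- A distribution that satisfies the balance equations is an equilibrium distribution. -/
theorem isEquilibrium_of_balance (Q : RateMatrix S) (hq : ∀ x, Q.exitRate x ≠ 0) {B : ℝ≥0}
    (hB : ∀ x, Q.exitRate x ≤ B) (π : ProbabilityMeasure S)
    (hπ : ∀ y, ∑' x, (π : Measure S) {x} * Q.rate x y = (π : Measure S) {y} * Q.exitRate y) :
    Q.IsEquilibrium π := by
  classical
  intro t y
  set p : S → ℝ≥0∞ := fun x => (π : Measure S) {x} with hp
  have hmt : ∀ z, Measurable fun u : ℝ => Q.trans u.toNNReal z y := fun z =>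
    (Q.measurable_trans z y).comp measurable_real_toNNReal
  have hpsum : ∑' x, p x = 1 := by
    have := lintegral_countable' (μ := (π : Measure S)) (fun _ => 1)
    simpa using this.symm
  -- When `trans_add_lintegral` is weighted by `p` and summed over x, both time integrals equal `K`:
  -- the left one by interchange, the right one by interchange and balance. As `K` is at most t·B,
  -- it is finite and cancels.
  set K : ℝ≥0∞ := ∫⁻ u in Set.Ioc 0 (t : ℝ), ∑' x, p x * Q.exitRate x * Q.trans u.toNNReal x y
    with hK
  have hK1 : ∑' x, p x * ∫⁻ u in Set.Ioc 0 (t : ℝ), Q.exitRate x * Q.trans u.toNNReal x y = K := by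
    rw [hK, lintegral_tsum fun x => ((hmt x).const_mul _).aemeasurable]
    refine tsum_congr fun x => ?_
    rw [← lintegral_const_mul _ ((hmt x).const_mul _)]
    simp only [mul_assoc]
  have hK2 : ∑' x, p x * ∫⁻ u in Set.Ioc 0 (t : ℝ), ∑' z, Q.rate x z * Q.trans u.toNNReal z y
      = K := by
    have hm : ∀ x, Measurable fun u : ℝ => ∑' z, Q.rate x z * Q.trans u.toNNReal z y :=
      fun x => Measurable.tsum fun z => (hmt z).const_mul _
    simp_rw [← lintegral_const_mul _ (hm _)]
    rw [← lintegral_tsum fun x => ((hm x).const_mul _).aemeasurable, hK]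
    refine lintegral_congr fun u => ?_
    simp_rw [← ENNReal.tsum_mul_left]
    rw [ENNReal.tsum_comm]
    refine tsum_congr fun z => ?_
    simp_rw [← mul_assoc]
    rw [ENNReal.tsum_mul_right, hπ]
  have hKfin : K ≠ ∞ := by
    refine ne_top_of_le_ne_top (b := ∫⁻ _ in Set.Ioc 0 (t : ℝ), B) ?_ (lintegral_mono fun u => ?_)
    · simp [ENNReal.mul_eq_top]
    · calc ∑' x, p x * Q.exitRate x * Q.trans u.toNNReal x y
          ≤ ∑' x, p x * B := by
            refine ENNReal.tsum_le_tsum fun x => ?_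
            refine (mul_le_of_le_one_right' (Q.trans_le_one _ _ _)).trans ?_
            gcongr
            exact_mod_cast hB x
        _ = B := by rw [ENNReal.tsum_mul_right, hpsum, one_mul]
  rw [law_state_eq]
  have h := congrArg (fun F : S → ℝ≥0∞ => ∑' x, p x * F x)
    (funext fun x => Q.trans_add_lintegral hq x y t)
  simp only [mul_add, ENNReal.tsum_add, hK1, hK2] at h
  have h1 : ∑' x, p x * (if x = y then 1 else 0) = p y := by simp
  rw [h1] at h
  exact (ENNReal.add_left_inj hKfin).1 h

end RateMatrix

/-! ### Uniqueness of the equilibrium -/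

theorem ENNReal.eq_of_le_of_tsum_eq {α : Type*} {a b : α → ℝ≥0∞} (hab : ∀ x, a x ≤ b x)
    (hfin : ∑' x, a x ≠ ∞) (h : ∑' x, a x = ∑' x, b x) : a = b := by
  by_contra hne
  obtain ⟨x, hx⟩ := Function.ne_iff.1 hne
  exact (ENNReal.tsum_lt_tsum hfin hab (lt_of_le_of_ne (hab x) hx)).ne h

/-- A positive stochastic matrix has at most one invariant distribution. -/
theorem invariant_unique {S : Type*} {K : S → S → ℝ≥0∞} (hpos : ∀ x y, 0 < K x y)
    (hK : ∀ x, ∑' y, K x y = 1) {p p' : S → ℝ≥0∞} (hp : ∑' x, p x = 1) (hp' : ∑' x, p' x = 1)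
    (hpK : ∀ y, ∑' x, p x * K x y = p y) (hpK' : ∀ y, ∑' x, p' x * K x y = p' y) : p = p' := by
  -- The pointwise minimum satisfies mK ≤ m, and K preserves total mass, so m is itself invariant.
  set m : S → ℝ≥0∞ := fun x => min (p x) (p' x) with hm
  have hmp : ∀ x, m x ≤ p x := fun x => min_le_left _ _
  have hmp' : ∀ x, m x ≤ p' x := fun x => min_le_right _ _
  have hmfin : ∑' x, m x ≠ ∞ :=
    ne_top_of_le_ne_top (by rw [hp]; exact ENNReal.one_ne_top) (ENNReal.tsum_le_tsum hmp)
  have hmass : ∑' y, ∑' x, m x * K x y = ∑' x, m x := by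
    rw [ENNReal.tsum_comm]
    simp_rw [ENNReal.tsum_mul_left, hK, mul_one]
  have hmK : (fun y => ∑' x, m x * K x y) = m := by
    refine ENNReal.eq_of_le_of_tsum_eq (fun y => le_min ?_ ?_) (by rwa [hmass]) hmass
    · rw [← hpK y]
      exact ENNReal.tsum_le_tsum fun x => mul_le_mul_left (hmp x) _
    · rw [← hpK' y]
      exact ENNReal.tsum_le_tsum fun x => mul_le_mul_left (hmp' x) _
  have hK1 : ∀ x y, K x y ≠ ∞ := fun x y =>
    ne_top_of_le_ne_top ENNReal.one_ne_top ((ENNReal.le_tsum y).trans_eq (hK x))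
  -- If m touches r at one state x, the sums of m z K(z,x) and r z K(z,x) over z agree. As m ≤ r and
  -- K > 0, this forces m = r everywhere. At any state m touches `p` or `p'`, which makes one of
  -- them dominate the other; equal masses conclude.
  have key : ∀ r : S → ℝ≥0∞, ∑' x, r x = 1 → (∀ y, ∑' x, r x * K x y = r y) → (∀ x, m x ≤ r x) →
      ∀ x, m x = r x → m = r := by
    intro r hr hrK hmr x hx
    have h1 : (fun z => m z * K z x) = fun z => r z * K z x := by
      have e1 : ∑' z, m z * K z x = m x := congrFun hmK x
      refine ENNReal.eq_of_le_of_tsum_eq (fun z => mul_le_mul_left (hmr z) _) ?_ ?_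
      · rw [e1]
        exact ne_top_of_le_ne_top hmfin (ENNReal.le_tsum x)
      · rw [e1, hrK, hx]
    ext z
    exact (ENNReal.mul_left_inj (hpos z x).ne' (hK1 z x)).1 (congrFun h1 z)
  rcases isEmpty_or_nonempty S with hS | ⟨⟨x⟩⟩
  · exact funext fun x => (hS.false x).elim
  rcases le_total (p x) (p' x) with h | h
  · have e := key p hp hpK hmp x (min_eq_left h)
    refine ENNReal.eq_of_le_of_tsum_eq (fun z => ?_) (by rw [hp]; exact ENNReal.one_ne_top)
      (hp.trans hp'.symm)
    rw [← e]
    exact hmp' z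
  · have e := key p' hp' hpK' hmp' x (min_eq_right h)
    refine (ENNReal.eq_of_le_of_tsum_eq (fun z => ?_) (by rw [hp']; exact ENNReal.one_ne_top)
      (hp'.trans hp.symm)).symm
    rw [← e]
    exact hmp z

namespace RateMatrix

variable {S : Type*} [Countable S] [MeasurableSpace S] [DiscreteMeasurableSpace S]

theorem tsum_measure_singleton (μ : Measure S) [IsProbabilityMeasure μ] : ∑' x, μ {x} = 1 := by
  have := lintegral_countable' (μ := μ) (fun _ => 1)
  simpa using this.symm

theorem IsEquilibrium.tsum_trans {Q : RateMatrix S} {π : ProbabilityMeasure S}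
    (h : Q.IsEquilibrium π) (t : ℝ≥0) (y : S) :
    ∑' x, (π : Measure S) {x} * Q.trans t x y = (π : Measure S) {y} := by
  rw [← h t y, law_state_eq]

theorem IsEquilibrium.eq {Q : RateMatrix S} (hQ : Q.IsNonexplosive)
    (hpos : ∀ x y, 0 < Q.trans 1 x y) {π π' : ProbabilityMeasure S} (h : Q.IsEquilibrium π)
    (h' : Q.IsEquilibrium π') : π' = π := by
  have := invariant_unique hpos (Q.tsum_trans hQ 1) (tsum_measure_singleton (π' : Measure S))
    (tsum_measure_singleton (π : Measure S)) (h'.tsum_trans 1) (h.tsum_trans 1)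
  exact Subtype.ext (Measure.ext_of_singleton fun x => congrFun this x)

/-- If `y` had mass zero, invariance at time 1 would give mass zero to every state from which `y` is
reached, hence to all states. -/
theorem IsEquilibrium.singleton_pos {Q : RateMatrix S} (hpos : ∀ x y, 0 < Q.trans 1 x y)
    {π : ProbabilityMeasure S} (h : Q.IsEquilibrium π) (y : S) : (π : Measure S) {y} ≠ 0 := by
  intro h0
  have h1 := h.tsum_trans 1 y
  rw [h0, ENNReal.tsum_eq_zero] at h1
  have h2 := tsum_measure_singleton (π : Measure S)
  rw [ENNReal.tsum_eq_zero.2 fun x => (mul_eq_zero.1 (h1 x)).resolve_right (hpos x y).ne'] at h2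
  exact zero_ne_one h2

/-! ### Positive recurrence by Kac's formula -/

/-- Trajectories that do not visit `x` at the times `1, …, k`. -/
def avoiding (x : S) (k : ℕ) : Set (ℕ → S) := {Y | ∀ i, 1 ≤ i → i ≤ k → Y i ≠ x}

theorem measurableSet_avoiding (x : S) (k : ℕ) : MeasurableSet (avoiding x k) := by
  have : avoiding x k = ⋂ i, ⋂ (_ : 1 ≤ i), ⋂ (_ : i ≤ k), (fun Y => Y i) ⁻¹' {x}ᶜ := by
    ext; simp [avoiding]
  rw [this]
  exact .iInter fun i => .iInter fun _ => .iInter fun _ =>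
    measurable_pi_apply i (measurableSet_singleton _).compl

/-- Mean holding time at step `k` on the event that `x` is avoided until then, from `y`. -/
def meanAvoiding (Q : RateMatrix S) (x : S) (k : ℕ) (y : S) : ℝ≥0∞ :=
  ∫⁻ Y, (avoiding x k).indicator (fun Y => (Q.exitRate (Y k) : ℝ≥0∞)⁻¹) Y
    ∂Q.jumpLaw (Measure.dirac y)

theorem measurable_avoiding_indicator (Q : RateMatrix S) (x : S) (k : ℕ) :
    Measurable ((avoiding x k).indicator fun Y => (Q.exitRate (Y k) : ℝ≥0∞)⁻¹) := by
  refine Measurable.indicator ?_ (measurableSet_avoiding x k)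
  have h1 : Measurable fun x : S => (Q.exitRate x : ℝ≥0∞)⁻¹ := .of_discrete
  exact h1.comp (measurable_pi_apply k)

theorem ae_jumpLaw_dirac_zero (Q : RateMatrix S) (y : S) :
    ∀ᵐ Y ∂Q.jumpLaw (Measure.dirac y), Y 0 = y := by
  rw [jumpLaw_dirac]
  have hm0 : Measurable fun Y : ℕ → S => Y 0 := measurable_pi_apply 0
  have hm : MeasurableSet {Y : ℕ → S | Y 0 = y} := hm0 (measurableSet_singleton y)
  rw [ae_map_iff (measurable_seqCons_right y).aemeasurable hm]
  exact .of_forall fun _ => rfl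

theorem meanAvoiding_zero (Q : RateMatrix S) (x y : S) :
    Q.meanAvoiding x 0 y = (Q.exitRate y : ℝ≥0∞)⁻¹ := by
  have : ∀ᵐ Y ∂Q.jumpLaw (Measure.dirac y), (avoiding x 0).indicator
      (fun Y => (Q.exitRate (Y 0) : ℝ≥0∞)⁻¹) Y = (Q.exitRate y : ℝ≥0∞)⁻¹ := by
    filter_upwards [Q.ae_jumpLaw_dirac_zero y] with Y hY
    rw [Set.indicator_of_mem, hY]
    intro i h1 h2
    omega
  rw [meanAvoiding, lintegral_congr_ae this]
  simp

-- First-step decomposition. Visits to `x` are forbidden only from index 1 on, so the starting state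
-- is free while the next one must differ from `x`.
open Classical in
theorem meanAvoiding_succ (Q : RateMatrix S) (x : S) (k : ℕ) (y : S) :
    Q.meanAvoiding x (k + 1) y =
      ∑' z, Q.jumpPMF y z * (if z = x then 0 else Q.meanAvoiding x k z) := by
  rw [meanAvoiding, lintegral_jumpLaw_dirac _ _ (Q.measurable_avoiding_indicator x (k + 1))]
  refine tsum_congr fun z => ?_
  congr 1
  have hiff : ∀ Y : ℕ → S, seqCons y Y ∈ avoiding x (k + 1) ↔ Y 0 ≠ x ∧ Y ∈ avoiding x k := by
    intro Y
    constructor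
    · intro h
      exact ⟨h 1 le_rfl (by omega), fun i h1 h2 => h (i + 1) (by omega) (by omega)⟩
    · rintro ⟨h0, h⟩ i h1 h2
      obtain ⟨i, rfl⟩ : ∃ j, i = j + 1 := ⟨i - 1, by omega⟩
      rcases Nat.eq_zero_or_pos i with rfl | hi
      · exact h0
      · exact h i hi (by omega)
  split_ifs with hz
  · rw [lintegral_congr_ae (g := fun _ => 0), lintegral_zero]
    filter_upwards [Q.ae_jumpLaw_dirac_zero z] with Y hY
    rw [Set.indicator_of_notMem]
    rw [hiff]
    exact fun h => h.1 (hY.trans hz)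
  · refine lintegral_congr_ae ?_
    filter_upwards [Q.ae_jumpLaw_dirac_zero z] with Y hY
    have h0 : Y 0 ≠ x := by rw [hY]; exact hz
    simp only [Set.indicator, hiff, h0, ne_eq, not_false_eq_true, true_and, seqCons_succ]

/-- The mean holding times accumulated before returning to `x` are bounded by means of a
distribution that satisfies the balance equations. -/
theorem mul_tsum_meanAvoiding_le (Q : RateMatrix S) (hq : ∀ x, Q.exitRate x ≠ 0) {p : S → ℝ≥0∞}
    (hp : ∑' x, p x = 1) (hbal : ∀ y, ∑' x, p x * Q.rate x y = p y * Q.exitRate y) (x : S) :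
    p x * Q.exitRate x * ∑' k, Q.meanAvoiding x k x ≤ 1 := by
  classical
  -- Balance says that this measure is invariant for the jump chain; the weight by exit rates
  -- cancels the mean holding time, so `A 0` is the mass of `p`.
  set m : S → ℝ≥0∞ := fun y => p y * Q.exitRate y with hm
  have hinv : ∀ z, ∑' y, m y * Q.jumpPMF y z = m z := by
    intro z
    simp only [hm]
    rw [← hbal]
    refine tsum_congr fun y => ?_
    rw [mul_assoc, exitRate_mul_jumpPMF Q (hq y)]
  set A : ℕ → ℝ≥0∞ := fun k => ∑' y, m y * Q.meanAvoiding x k y with hA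
  have hA0 : A 0 = 1 := by
    rw [hA, ← hp]
    refine tsum_congr fun y => ?_
    rw [meanAvoiding_zero, mul_assoc, ENNReal.mul_inv_cancel (by simpa using hq y) (by simp),
      mul_one]
  -- By invariance, `A (k + 1)` is `A k` without its term at `x`. The relation telescopes, and the
  -- terms split off sum to at most `A 0`.
  have hstep : ∀ k, m x * Q.meanAvoiding x k x + A (k + 1) = A k := by
    intro k
    have h1 : A (k + 1) = ∑' z, if z = x then 0 else m z * Q.meanAvoiding x k z := by
      simp only [hA, meanAvoiding_succ, ← ENNReal.tsum_mul_left]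
      rw [ENNReal.tsum_comm]
      refine tsum_congr fun z => ?_
      simp_rw [← mul_assoc]
      rw [ENNReal.tsum_mul_right, hinv]
      split_ifs <;> simp
    rw [h1]
    exact (ENNReal.tsum_eq_add_tsum_ite (f := fun z => m z * Q.meanAvoiding x k z) x).symm
  have hsum : ∀ n, ∑ k ∈ Finset.range n, m x * Q.meanAvoiding x k x + A n = 1 := by
    intro n
    induction n with
    | zero => simpa using hA0
    | succ n ih => rw [Finset.sum_range_succ, add_assoc, hstep, ih]
  rw [← ENNReal.tsum_mul_left, ENNReal.tsum_eq_iSup_nat]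
  exact iSup_le fun n => le_self_add.trans_eq (hsum n)

-- Up to the first return at index n, the steps k < n are among those that have avoided `x`, and
-- their holding times add up to the return time. Without a return, the right-hand side is the full
-- sum of holding times, which is infinite.
open Classical in
theorem returnTime_le (Q : RateMatrix S) (hq : ∀ x, Q.exitRate x ≠ 0) (x : S) (ω : Path S)
    (hω : ∀ n, 0 < ω.2 n) (hω' : ∑' n, Q.holding n ω = ∞) :
    Q.returnTime x ω ≤ ∑' k, if ω.1 ∈ avoiding x k then Q.holding k ω else 0 := by
  by_cases hex : ∃ n, 1 ≤ n ∧ ω.1 n = x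
  · set n := Nat.find hex with hn
    obtain ⟨hn1, hnx⟩ := Nat.find_spec hex
    have hJ : Q.jumpTime n ω ≤ ∑' k, if ω.1 ∈ avoiding x k then Q.holding k ω else 0 := by
      refine le_trans (le_of_eq ?_) (ENNReal.sum_le_tsum (Finset.range n))
      refine Finset.sum_congr rfl fun k hk => ?_
      rw [if_pos]
      intro i h1 h2 h3
      exact Nat.find_min hex (m := i) (by have := Finset.mem_range.1 hk; omega) ⟨h1, h3⟩
    refine le_trans ?_ hJ
    have hfin : Q.jumpTime n ω ≠ ∞ := by
      refine ENNReal.sum_ne_top.2 fun k _ => ENNReal.div_ne_top ENNReal.ofReal_ne_top ?_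
      exact_mod_cast hq _
    have hcoe : ((Q.jumpTime n ω).toNNReal : ℝ≥0∞) = Q.jumpTime n ω := ENNReal.coe_toNNReal hfin
    unfold returnTime
    refine (iInf_le _ (Q.jumpTime n ω).toNNReal).trans ?_
    refine (iInf₂_le ?_ ?_).trans_eq hcoe
    · rw [hcoe]; exact Q.jumpTime_mono ω hn1
    · rw [state_eq_some_iff]
      -- A positive clock gives the n-th state a positive holding time, so the chain is in `x` at
      -- the jump time itself.
      refine ⟨n, hcoe.ge, ?_, hnx⟩
      rw [hcoe, jumpTime, jumpTime, Finset.sum_range_succ]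
      refine ENNReal.lt_add_right hfin ?_
      simp [holding, hω n]
  · have : ∑' k, (if ω.1 ∈ avoiding x k then Q.holding k ω else 0) = ∞ := by
      rw [← hω']
      refine tsum_congr fun k => if_pos ?_
      intro i h1 _ h3
      exact hex ⟨i, h1, h3⟩
    rw [this]
    exact le_top

/-- Each clock is independent of the visited states, so the expectation of the bound in
`returnTime_le` is the mean of a clock times the sum controlled by `mul_tsum_meanAvoiding_le`. -/
theorem isPositiveRecurrent_of_balance (Q : RateMatrix S) (hq : ∀ x, Q.exitRate x ≠ 0)
    (hQ : Q.IsNonexplosive) {p : S → ℝ≥0∞} (hp : ∑' x, p x = 1)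
    (hbal : ∀ y, ∑' x, p x * Q.rate x y = p y * Q.exitRate y) (hpos : ∀ x, p x ≠ 0) :
    Q.IsPositiveRecurrent := by
  classical
  intro x
  right
  have hae : ∀ᵐ ω ∂Q.lawFrom x, Q.returnTime x ω ≤
      ∑' k, (avoiding x k).indicator (fun Y => (Q.exitRate (Y k) : ℝ≥0∞)⁻¹) ω.1 *
        ENNReal.ofReal (ω.2 k) := by
    filter_upwards [hQ x, Q.ae_law_of_ae_clockLaw (Measure.dirac x) ae_clockLaw_pos] with ω h1 h2
    refine (Q.returnTime_le hq x ω h2 h1).trans_eq (tsum_congr fun k => ?_)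
    by_cases h : ω.1 ∈ avoiding x k
    · rw [if_pos h, Set.indicator_of_mem h, holding, ENNReal.div_eq_inv_mul]
    · rw [if_neg h, Set.indicator_of_notMem h, zero_mul]
  refine (lintegral_mono_ae hae).trans_lt ?_
  set c := ∫⁻ s, ENNReal.ofReal s ∂expMeasure 1 with hc
  have hmk : ∀ k, Measurable fun ω : Path S =>
      (avoiding x k).indicator (fun Y => (Q.exitRate (Y k) : ℝ≥0∞)⁻¹) ω.1 *
        ENNReal.ofReal (ω.2 k) := fun k =>
    ((Q.measurable_avoiding_indicator x k).comp measurable_fst).mul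
      ((measurable_pi_apply k).comp measurable_snd).ennreal_ofReal
  rw [lintegral_tsum fun k => (hmk k).aemeasurable]
  have hk : ∀ k, ∫⁻ ω, (avoiding x k).indicator (fun Y => (Q.exitRate (Y k) : ℝ≥0∞)⁻¹) ω.1 *
        ENNReal.ofReal (ω.2 k) ∂Q.lawFrom x = Q.meanAvoiding x k x * c := by
    intro k
    rw [lawFrom, lintegral_law_eq _ _ (hmk k), meanAvoiding,
      ← lintegral_mul_const _ (Q.measurable_avoiding_indicator x k)]
    refine lintegral_congr fun Y => ?_
    have hmeas : Measurable fun ξ : ℕ → ℝ => ENNReal.ofReal (ξ k) :=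
      (measurable_pi_apply k).ennreal_ofReal
    have hconst := lintegral_const_mul (μ := clockLaw)
      ((avoiding x k).indicator (fun Y => (Q.exitRate (Y k) : ℝ≥0∞)⁻¹) Y) hmeas
    refine hconst.trans ?_
    congr 1
    exact (measurePreserving_eval_infinitePi (fun _ : ℕ => expMeasure 1) k).lintegral_comp
      ENNReal.measurable_ofReal
  simp_rw [hk]
  rw [ENNReal.tsum_mul_right]
  refine ENNReal.mul_lt_top ?_ lintegral_id_expMeasure_one_lt_top
  have h1 := Q.mul_tsum_meanAvoiding_le hq hp hbal x
  rw [lt_top_iff_ne_top]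
  intro h2
  rw [h2, ENNReal.mul_top (mul_ne_zero (hpos x) (by exact_mod_cast hq x))] at h1
  exact absurd h1 (by simp)

end RateMatrix

/-! ### Foster's criterion -/

open Filter Topology in
/-- Foster's criterion: a stochastic matrix with a Lyapunov function has an invariant distribution,
for which the mean of the drift is controlled. -/
theorem exists_invariant_of_drift {S : Type*} {K : S → S → ℝ≥0∞} (hK : ∀ x, ∑' y, K x y = 1)
    {V : S → ℝ≥0∞} {g : S → ℝ≥0} {c : ℝ≥0} (x₀ : S) (hV : V x₀ ≠ ∞)
    (hdrift : ∀ x, ∑' y, K x y * V y + g x ≤ V x + c) (hg : ∀ R : ℝ≥0, {x | g x ≤ R}.Finite) :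
    ∃ p : S → ℝ≥0∞, ∑' x, p x = 1 ∧ (∀ y, ∑' x, p x * K x y = p y) ∧ ∑' x, p x * g x ≤ c := by
  classical
  -- The law after n steps from `x₀`. Averaging the drift inequality over it and summing over n
  -- gives `hsum`.
  let μ : ℕ → S → ℝ≥0∞ := fun n => Nat.rec (fun x => if x = x₀ then 1 else 0)
    (fun _ ν y => ∑' x, ν x * K x y) n
  have hμs : ∀ n y, μ (n + 1) y = ∑' x, μ n x * K x y := fun _ _ => rfl
  have hμ1 : ∀ n, ∑' x, μ n x = 1 := by
    intro n
    induction n with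
    | zero => simp [μ]
    | succ n ih =>
      simp_rw [hμs]
      rw [ENNReal.tsum_comm]
      simp_rw [ENNReal.tsum_mul_left, hK, mul_one, ih]
  have hstep : ∀ n, ∑' x, μ (n + 1) x * V x + ∑' x, μ n x * g x ≤ ∑' x, μ n x * V x + c := by
    intro n
    have h1 : ∑' x, μ (n + 1) x * V x = ∑' x, μ n x * ∑' y, K x y * V y := by
      simp_rw [hμs, ← ENNReal.tsum_mul_right, ← ENNReal.tsum_mul_left]
      rw [ENNReal.tsum_comm]
      simp_rw [mul_assoc]
    have h2 : (c : ℝ≥0∞) = ∑' x, μ n x * c := by rw [ENNReal.tsum_mul_right, hμ1, one_mul]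
    rw [h1, h2, ← ENNReal.tsum_add, ← ENNReal.tsum_add]
    simp_rw [← mul_add]
    exact ENNReal.tsum_le_tsum fun x => mul_le_mul_right (hdrift x) _
  have hsum : ∀ n : ℕ, ∑' x, μ n x * V x + ∑ k ∈ Finset.range n, ∑' x, μ k x * g x ≤
      V x₀ + n * c := by
    intro n
    induction n with
    | zero => simp [μ]
    | succ n ih =>
      rw [Finset.sum_range_succ, add_comm (∑ k ∈ _, _), ← add_assoc]
      calc _ ≤ ∑' x, μ n x * V x + c + ∑ k ∈ Finset.range n, ∑' x, μ k x * g x := by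
            exact add_le_add_left (hstep n) _
        _ = (∑' x, μ n x * V x + ∑ k ∈ Finset.range n, ∑' x, μ k x * g x) + c := by ring
        _ ≤ V x₀ + n * c + c := by gcongr
        _ = V x₀ + (n + 1 : ℕ) * c := by push_cast; ring
  let A : ℕ → S → ℝ≥0∞ := fun n y => ((n + 1 : ℕ) : ℝ≥0∞)⁻¹ * ∑ k ∈ Finset.range (n + 1), μ k y
  have hinv : ∀ n : ℕ, ((n + 1 : ℕ) : ℝ≥0∞)⁻¹ * (n + 1 : ℕ) = 1 := fun n =>
    ENNReal.inv_mul_cancel (by simp) (ENNReal.natCast_ne_top _)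
  have hAw : ∀ (n : ℕ) (w : S → ℝ≥0∞), ∑' x, A n x * w x =
      ((n + 1 : ℕ) : ℝ≥0∞)⁻¹ * ∑ k ∈ Finset.range (n + 1), ∑' x, μ k x * w x := by
    intro n w
    simp only [A, mul_assoc, ENNReal.tsum_mul_left, Finset.sum_mul]
    rw [Summable.tsum_finsetSum fun _ _ => ENNReal.summable]
  have hA1 : ∀ n, ∑' x, A n x = 1 := by
    intro n
    have := hAw n (fun _ => 1)
    simp only [mul_one, hμ1, Finset.sum_const, Finset.card_range, nsmul_eq_mul] at this
    rw [this, hinv]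
  have hAg : ∀ n, ∑' x, A n x * g x ≤ ((n + 1 : ℕ) : ℝ≥0∞)⁻¹ * V x₀ + c := by
    intro n
    rw [hAw]
    calc _ ≤ ((n + 1 : ℕ) : ℝ≥0∞)⁻¹ * (V x₀ + (n + 1 : ℕ) * c) := by
          gcongr
          exact le_add_self.trans (hsum (n + 1))
      _ = _ := by rw [mul_add, ← mul_assoc, hinv, one_mul]
  -- One application of K shifts the Cesàro mean by one index, and only the end terms, each at most
  -- 1, fail to cancel.
  have hAK : ∀ n y, ∑' x, A n x * K x y ≤ A n y + ((n + 1 : ℕ) : ℝ≥0∞)⁻¹ := by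
    intro n y
    rw [hAw]
    simp_rw [← hμs]
    have h1 : ∑ k ∈ Finset.range (n + 1), μ (k + 1) y ≤
        ∑ k ∈ Finset.range (n + 1), μ k y + 1 := by
      have h2 : μ (n + 1) y ≤ 1 := (ENNReal.le_tsum y).trans_eq (hμ1 (n + 1))
      calc _ ≤ ∑ k ∈ Finset.range (n + 1), μ (k + 1) y + μ 0 y := le_self_add
        _ = ∑ k ∈ Finset.range (n + 1), μ k y + μ (n + 1) y := by
            rw [← Finset.sum_range_succ' (fun k => μ k y), Finset.sum_range_succ]
        _ ≤ _ := by gcongr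
    calc _ ≤ ((n + 1 : ℕ) : ℝ≥0∞)⁻¹ * (∑ k ∈ Finset.range (n + 1), μ k y + 1) := by gcongr
      _ = _ := by rw [mul_add, mul_one]
  -- Values lie in the compact space [0, ∞], so one ultrafilter yields limits at all states at once,
  -- with no diagonal extraction.
  have hlim : ∀ y, ∃ a, Tendsto (fun n => A n y) (hyperfilter ℕ : Filter ℕ) (𝓝 a) := fun y =>
    ⟨_, ((hyperfilter ℕ).map fun n => A n y).le_nhds_lim⟩
  choose p hp using hlim
  have hle : (hyperfilter ℕ : Filter ℕ) ≤ atTop := Nat.hyperfilter_le_atTop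
  have hzero : Tendsto (fun n : ℕ => ((n + 1 : ℕ) : ℝ≥0∞)⁻¹) (hyperfilter ℕ : Filter ℕ) (𝓝 0) :=
    (ENNReal.tendsto_inv_nat_nhds_zero.comp (tendsto_add_atTop_nat 1)).mono_left hle
  have hfin : ∀ (F : Finset S) (w : S → ℝ≥0∞), (∀ x, w x ≠ ∞) →
      Tendsto (fun n => ∑ x ∈ F, A n x * w x) (hyperfilter ℕ : Filter ℕ)
        (𝓝 (∑ x ∈ F, p x * w x)) := fun F w hw =>
    tendsto_finsetSum _ fun x _ => ENNReal.Tendsto.mul_const (hp x) (Or.inr (hw x))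
  have hfatou : ∀ (w : S → ℝ≥0∞) (B : ℕ → ℝ≥0∞) (b : ℝ≥0∞), (∀ x, w x ≠ ∞) →
      (∀ n, ∑' x, A n x * w x ≤ B n) → Tendsto B (hyperfilter ℕ : Filter ℕ) (𝓝 b) →
      ∑' x, p x * w x ≤ b := by
    intro w B b hw hB hBb
    rw [ENNReal.tsum_eq_iSup_sum]
    exact iSup_le fun F => le_of_tendsto_of_tendsto (hfin F w hw) hBb
      (.of_forall fun n => (ENNReal.sum_le_tsum F).trans (hB n))
  have hBlim : Tendsto (fun n : ℕ => ((n + 1 : ℕ) : ℝ≥0∞)⁻¹ * V x₀ + c)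
      (hyperfilter ℕ : Filter ℕ) (𝓝 c) := by
    have := (ENNReal.Tendsto.mul_const hzero (Or.inr hV)).add_const (c : ℝ≥0∞)
    simpa using this
  have hpg : ∑' x, p x * g x ≤ c := hfatou _ _ _ (fun x => ENNReal.coe_ne_top) hAg hBlim
  have hp_le : ∑' x, p x ≤ 1 := by
    have := hfatou (fun _ => 1) (fun _ => 1) 1 (fun _ => ENNReal.one_ne_top)
      (fun n => by simpa using (hA1 n).le) tendsto_const_nhds
    simpa using this
  -- Tightness: off the finite set where g ≤ m + 1, Markov's inequality bounds the mass by the mean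
  -- of g over m + 1. Then m tends to infinity.
  have hp_ge : 1 ≤ ∑' x, p x := by
    have hR : ∀ m : ℕ, 1 ≤ ∑' x, p x + ((m + 1 : ℕ) : ℝ≥0∞)⁻¹ * c := by
      intro m
      set F := (hg (m + 1 : ℕ)).toFinset with hF
      have h1 : ∀ n, 1 ≤ ∑ x ∈ F, A n x * 1 +
          ((m + 1 : ℕ) : ℝ≥0∞)⁻¹ * (((n + 1 : ℕ) : ℝ≥0∞)⁻¹ * V x₀ + c) := by
        intro n
        calc (1 : ℝ≥0∞) = ∑' x, A n x := (hA1 n).symm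
          _ ≤ ∑' x, ((if x ∈ F then A n x else 0) + ((m + 1 : ℕ) : ℝ≥0∞)⁻¹ * (A n x * g x)) := by
              refine ENNReal.tsum_le_tsum fun x => ?_
              by_cases hx : x ∈ F
              · rw [if_pos hx]; exact le_self_add
              · have hx' : ((m + 1 : ℕ) : ℝ≥0) ≤ g x := by
                  by_contra h
                  exact hx (by simpa [hF] using (not_le.1 h).le)
                rw [if_neg hx, zero_add, mul_left_comm]
                have h3 : (1 : ℝ≥0∞) ≤ ((m + 1 : ℕ) : ℝ≥0∞)⁻¹ * g x := by
                  rw [← hinv m]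
                  gcongr
                  exact_mod_cast hx'
                exact le_mul_of_one_le_right' h3
          _ = ∑ x ∈ F, A n x * 1 + ((m + 1 : ℕ) : ℝ≥0∞)⁻¹ * ∑' x, A n x * g x := by
              rw [ENNReal.tsum_add, ENNReal.tsum_mul_left, tsum_eq_sum (s := F)]
              · congr 1
                exact Finset.sum_congr rfl fun x hx => by simp [hx]
              · intro x hx
                simp [hx]
          _ ≤ _ := by gcongr; exact hAg n
      have h2 := (hfin F (fun _ => 1) fun _ => ENNReal.one_ne_top).add
        (ENNReal.Tendsto.const_mul (a := ((m + 1 : ℕ) : ℝ≥0∞)⁻¹) hBlim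
          (Or.inr (by simp)))
      refine (ge_of_tendsto' h2 h1).trans ?_
      gcongr
      simpa using ENNReal.sum_le_tsum F
    have hl : Tendsto (fun m : ℕ => ∑' x, p x + ((m + 1 : ℕ) : ℝ≥0∞)⁻¹ * c) (hyperfilter ℕ : Filter ℕ)
        (𝓝 (∑' x, p x)) := by
      have := (ENNReal.Tendsto.mul_const hzero (Or.inr (ENNReal.coe_ne_top (r := c)))).const_add
        (∑' x, p x)
      simpa using this
    exact ge_of_tendsto' hl hR
  have hp1 := le_antisymm hp_le hp_ge
  have hK1 : ∀ x y, K x y ≠ ∞ := fun x y =>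
    ne_top_of_le_ne_top ENNReal.one_ne_top ((ENNReal.le_tsum y).trans_eq (hK x))
  -- Fatou gives only this inequality; equality follows since both sides have total mass 1.
  have hpK : ∀ y, ∑' x, p x * K x y ≤ p y := by
    intro y
    refine hfatou _ _ _ (fun x => hK1 x y) (fun n => hAK n y) ?_
    simpa using (hp y).add hzero
  have hmass : ∑' y, ∑' x, p x * K x y = ∑' x, p x := by
    rw [ENNReal.tsum_comm]
    simp_rw [ENNReal.tsum_mul_left, hK, mul_one]
  exact ⟨p, hp1, fun y => congrFun (ENNReal.eq_of_le_of_tsum_eq hpK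
    (by rw [hmass, hp1]; exact ENNReal.one_ne_top) hmass) y, hpg⟩

namespace RateMatrix

variable {S : Type*} [Countable S] [MeasurableSpace S] [DiscreteMeasurableSpace S]

/-- Foster's criterion for a chain with bounded exit rates. -/
theorem exists_balance_of_drift (Q : RateMatrix S) {B : ℝ≥0} (hB0 : B ≠ 0)
    (hB : ∀ x, Q.exitRate x ≤ B) {V f : S → ℝ≥0} {C : ℝ≥0} (x₀ : S)
    (hdrift : ∀ x, ∑' y, (Q.rate x y : ℝ≥0∞) * V y + f x ≤ Q.exitRate x * V x + C)
    (hf : ∀ R : ℝ≥0, {x | f x ≤ R}.Finite) :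
    ∃ π : ProbabilityMeasure S,
      (∀ y, ∑' x, (π : Measure S) {x} * Q.rate x y = (π : Measure S) {y} * Q.exitRate y) ∧
      ∑' x, (π : Measure S) {x} * f x ≤ C := by
  classical
  have hBne : (B : ℝ≥0∞) ≠ 0 := by exact_mod_cast hB0
  have hBi : (B : ℝ≥0∞)⁻¹ ≠ ∞ := by simpa using hB0
  have hBi0 : (B : ℝ≥0∞)⁻¹ ≠ 0 := by simp
  have hBB : (B : ℝ≥0∞)⁻¹ * B = 1 := ENNReal.inv_mul_cancel hBne ENNReal.coe_ne_top
  let a : S → ℝ≥0∞ := fun x => 1 - (B : ℝ≥0∞)⁻¹ * Q.exitRate x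
  have ha : ∀ x, a x + (B : ℝ≥0∞)⁻¹ * Q.exitRate x = 1 := by
    intro x
    refine tsub_add_cancel_of_le ?_
    rw [← hBB]
    gcongr
    exact_mod_cast hB x
  -- Uniformization, K = I + Q/B with Q the generator. The bound on exit rates makes the diagonal
  -- nonnegative, and invariance under K is exactly balance. Drift and constant are divided by B.
  let K : S → S → ℝ≥0∞ := fun x y => (if y = x then a x else 0) + (B : ℝ≥0∞)⁻¹ * Q.rate x y
  have hKw : ∀ (x : S) (w : S → ℝ≥0∞), ∑' y, K x y * w y =
      a x * w x + (B : ℝ≥0∞)⁻¹ * ∑' y, Q.rate x y * w y := by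
    intro x w
    simp only [K, add_mul, ENNReal.tsum_add, mul_assoc, ENNReal.tsum_mul_left]
    congr 1
    rw [tsum_eq_single x fun y hy => by simp [hy]]
    simp
  have hK : ∀ x, ∑' y, K x y = 1 := by
    intro x
    have := hKw x fun _ => 1
    simpa [Q.tsum_rate_eq, ha] using this
  have hcoe : ((B⁻¹ : ℝ≥0) : ℝ≥0∞) = (B : ℝ≥0∞)⁻¹ := ENNReal.coe_inv hB0
  obtain ⟨p, hp1, hpK, hpg⟩ := exists_invariant_of_drift hK (V := fun x => V x)
    (g := fun x => B⁻¹ * f x) (c := B⁻¹ * C) x₀ ENNReal.coe_ne_top (fun x => by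
      rw [hKw]
      simp only [ENNReal.coe_mul, hcoe]
      calc a x * V x + (B : ℝ≥0∞)⁻¹ * ∑' y, (Q.rate x y : ℝ≥0∞) * V y + (B : ℝ≥0∞)⁻¹ * f x
          = a x * V x + (B : ℝ≥0∞)⁻¹ * (∑' y, (Q.rate x y : ℝ≥0∞) * V y + f x) := by
            rw [mul_add, add_assoc]
        _ ≤ a x * V x + (B : ℝ≥0∞)⁻¹ * (Q.exitRate x * V x + C) := by
            exact add_le_add_right (mul_le_mul_right (hdrift x) _) _
        _ = (a x + (B : ℝ≥0∞)⁻¹ * Q.exitRate x) * V x + (B : ℝ≥0∞)⁻¹ * C := by ring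
        _ = _ := by rw [ha, one_mul]) (fun R => by
      refine (hf (B * R)).subset fun x hx => ?_
      have hx : B⁻¹ * f x ≤ R := hx
      have : f x ≤ B * R := by
        calc f x = B * (B⁻¹ * f x) := by rw [← mul_assoc, mul_inv_cancel₀ hB0, one_mul]
          _ ≤ B * R := by gcongr
      exact this)
  let P : PMF S := ⟨p, hp1 ▸ ENNReal.summable.hasSum⟩
  have hP : ∀ x, P.toMeasure {x} = p x := fun x =>
    PMF.toMeasure_apply_singleton P x (measurableSet_singleton x)
  refine ⟨⟨P.toMeasure, inferInstance⟩, fun y => ?_, ?_⟩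
  · simp only [ProbabilityMeasure.coe_mk, hP]
    have h1 := hpK y
    have hfin : p y * a y ≠ ∞ := by
      refine ENNReal.mul_ne_top ?_ (ne_top_of_le_ne_top ENNReal.one_ne_top tsub_le_self)
      exact ne_top_of_le_ne_top ENNReal.one_ne_top ((ENNReal.le_tsum y).trans_eq hp1)
    have h2 : ∑' x, p x * K x y = p y * a y + (B : ℝ≥0∞)⁻¹ * ∑' x, p x * Q.rate x y := by
      simp only [K, mul_add, ENNReal.tsum_add, mul_left_comm _ (B : ℝ≥0∞)⁻¹, ENNReal.tsum_mul_left]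
      congr 1
      rw [tsum_eq_single y fun x hx => by simp [hx.symm]]
      simp
    have h3 : p y = p y * a y + (B : ℝ≥0∞)⁻¹ * (p y * Q.exitRate y) := by
      rw [mul_left_comm, ← mul_add, ha, mul_one]
    have h4 := (ENNReal.add_right_inj hfin).1 (h2.symm.trans (h1.trans h3))
    exact (ENNReal.mul_right_inj hBi0 hBi).1 h4
  · simp only [ProbabilityMeasure.coe_mk, hP]
    simp only [ENNReal.coe_mul, hcoe, mul_left_comm _ (B : ℝ≥0∞)⁻¹, ENNReal.tsum_mul_left] at hpg
    exact (ENNReal.mul_le_mul_iff_right hBi0 hBi).1 hpg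

end RateMatrix

/-! ### Expectations in equilibrium -/

namespace RateMatrix

variable {S : Type*} [Countable S] [MeasurableSpace S] [DiscreteMeasurableSpace S]

/-- Explosion has probability zero, so the value of `F` at `none` plays no role. -/
theorem IsEquilibrium.lintegral_state {Q : RateMatrix S} {B : ℝ≥0} (hB : ∀ x, Q.exitRate x ≤ B)
    {π : ProbabilityMeasure S} (h : Q.IsEquilibrium π) (F : Option S → ℝ≥0∞) (t : ℝ≥0) :
    ∫⁻ ω, F (Q.state t ω) ∂Q.law (π : Measure S) = ∑' y, (π : Measure S) {y} * F (some y) := by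
  have hae : ∀ᵐ ω ∂Q.law (π : Measure S), F (Q.state t ω) =
      ∑' y, {ω | Q.state t ω = some y}.indicator (fun _ => F (some y)) ω := by
    filter_upwards [Q.ae_tsum_holding hB (π : Measure S)] with ω hω
    obtain ⟨y, hy⟩ := Option.ne_none_iff_exists'.1 (Q.state_ne_none t ω hω)
    have hmem : ω ∈ {ω | Q.state t ω = some y} := hy
    rw [tsum_eq_single y, Set.indicator_of_mem hmem, hy]
    intro z hz
    refine Set.indicator_of_notMem (fun hz' => hz ?_) _
    have hz' : Q.state t ω = some z := hz'
    exact Option.some_injective _ (hz'.symm.trans hy)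
  rw [lintegral_congr_ae hae, lintegral_tsum fun y =>
    (measurable_const.indicator (Q.measurableSet_state t y)).aemeasurable]
  refine tsum_congr fun y => ?_
  rw [lintegral_indicator_const (Q.measurableSet_state t y), h t y, mul_comm]

end RateMatrix

/-! ### Drift of the queue-length chain -/

namespace TTC

variable {N : ℕ}

theorem sum_joinProb_mul (T : ℝ) (A : Fin N → Finset (Fin N)) (q : Fin N → ℕ) (w : Fin N → ℝ≥0) :
    ∑ i, joinProb T A q i * w i =
      ∑ h, (N : ℝ≥0)⁻¹ * ∑ r ∈ A h, ((A h).card : ℝ≥0)⁻¹ * w (route T q h r) := by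
  simp only [joinProb, Finset.sum_mul]
  rw [Finset.sum_comm]
  refine Finset.sum_congr rfl fun h _ => ?_
  simp only [Finset.mul_sum, Finset.sum_mul]
  rw [Finset.sum_comm]
  refine Finset.sum_congr rfl fun r _ => ?_
  rw [Finset.sum_eq_single (route T q h r) (fun i _ hi => by simp [hi.symm]) (by simp)]
  simp [mul_assoc]

theorem sum_joinProb (hN : 0 < N) (T : ℝ) {A : Fin N → Finset (Fin N)}
    (hA : ∀ h, (A h).Nonempty) (q : Fin N → ℕ) : ∑ i, joinProb T A q i = 1 := by
  have h := sum_joinProb_mul T A q fun _ => 1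
  simp only [mul_one] at h
  rw [h]
  have hc : ∀ h, ((A h).card : ℝ≥0) ≠ 0 := fun h => by
    exact_mod_cast (Finset.card_pos.2 (hA h)).ne'
  have hN' : (N : ℝ≥0) ≠ 0 := by exact_mod_cast hN.ne'
  simp [hc, hN']

theorem route_le {T : ℝ} (hT : 0 ≤ T) (q : Fin N → ℕ) (h r : Fin N) : q (route T q h r) ≤ q h := by
  unfold route
  split_ifs with hlt
  · have : (q r : ℝ) ≤ q h := by linarith
    exact_mod_cast this
  · exact le_rfl

/-- The queue joined is never longer than the default one, and the default is uniform. The drift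
bound uses nothing else about the routing except that the joining probabilities sum to 1. -/
theorem sum_joinProb_mul_queue_le (hN : 0 < N) {T : ℝ} (hT : 0 ≤ T) {A : Fin N → Finset (Fin N)}
    (hA : ∀ h, (A h).Nonempty) (q : Fin N → ℕ) :
    N * ∑ i, joinProb T A q i * q i ≤ ∑ i, (q i : ℝ≥0) := by
  have hc : ∀ h, ((A h).card : ℝ≥0) ≠ 0 := fun h => by
    exact_mod_cast (Finset.card_pos.2 (hA h)).ne'
  have hN' : (N : ℝ≥0) ≠ 0 := by exact_mod_cast hN.ne'
  rw [sum_joinProb_mul T A q fun i => (q i : ℝ≥0), ← Finset.mul_sum, ← mul_assoc,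
    mul_inv_cancel₀ hN', one_mul]
  refine Finset.sum_le_sum fun h _ => ?_
  calc ∑ r ∈ A h, ((A h).card : ℝ≥0)⁻¹ * (q (route T q h r) : ℝ≥0)
      ≤ ∑ r ∈ A h, ((A h).card : ℝ≥0)⁻¹ * (q h : ℝ≥0) := by
        gcongr with r
        exact route_le hT q h r
    _ = q h := by
        rw [Finset.sum_const, nsmul_eq_mul, ← mul_assoc, mul_inv_cancel₀ (hc h), one_mul]

theorem tsum_rate_mul (lam : ℝ≥0) (T : ℝ) (A : Fin N → Finset (Fin N)) (q : Fin N → ℕ)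
    (F : (Fin N → ℕ) → ℝ≥0) :
    ∑' q', ((chain N lam T A).rate q q' : ℝ≥0∞) * F q' =
      ((∑ i, N * lam * joinProb T A q i * F (Function.update q i (q i + 1)) +
        ∑ i, if 0 < q i then F (Function.update q i (q i - 1)) else 0 : ℝ≥0) : ℝ≥0∞) := by
  simp only [chain, rate, ENNReal.coe_add, ENNReal.ofNNReal_finsetSum, add_mul, Finset.sum_mul]
  rw [ENNReal.tsum_add, Summable.tsum_finsetSum fun _ _ => ENNReal.summable,
    Summable.tsum_finsetSum fun _ _ => ENNReal.summable]
  congr 1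
  · refine Finset.sum_congr rfl fun i _ => ?_
    rw [tsum_eq_single (Function.update q i (q i + 1)) fun q' hq' => by simp [hq']]
    simp
  · refine Finset.sum_congr rfl fun i _ => ?_
    rw [tsum_eq_single (Function.update q i (q i - 1)) fun q' hq' => by simp [hq']]
    split_ifs <;> simp_all

theorem exitRate_eq (hN : 0 < N) (lam : ℝ≥0) (T : ℝ) {A : Fin N → Finset (Fin N)}
    (hA : ∀ h, (A h).Nonempty) (q : Fin N → ℕ) :
    (chain N lam T A).exitRate q = N * lam + ∑ i, if 0 < q i then 1 else 0 := by
  have h := tsum_rate_mul lam T A q fun _ => 1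
  simp only [ENNReal.coe_one, mul_one, RateMatrix.tsum_rate_eq] at h
  rw [ENNReal.coe_inj.1 h, ← Finset.mul_sum, sum_joinProb hN T hA, mul_one]

theorem exitRate_ne_zero (hN : 0 < N) {lam : ℝ≥0} (hlam0 : 0 < lam) (T : ℝ)
    {A : Fin N → Finset (Fin N)} (hA : ∀ h, (A h).Nonempty) (q : Fin N → ℕ) :
    (chain N lam T A).exitRate q ≠ 0 := by
  rw [exitRate_eq hN lam T hA]
  have : (0 : ℝ≥0) < N := by exact_mod_cast hN
  positivity

theorem exitRate_le (hN : 0 < N) (lam : ℝ≥0) (T : ℝ) {A : Fin N → Finset (Fin N)}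
    (hA : ∀ h, (A h).Nonempty) (q : Fin N → ℕ) :
    (chain N lam T A).exitRate q ≤ N * lam + N := by
  rw [exitRate_eq hN lam T hA]
  gcongr
  calc ∑ i, (if 0 < q i then 1 else 0 : ℝ≥0) ≤ ∑ _i : Fin N, 1 :=
        Finset.sum_le_sum fun i _ => by split_ifs <;> simp
    _ = N := by simp

/-- Sum of the squares of the queue lengths. -/
def energy (q : Fin N → ℕ) : ℝ≥0 := ∑ i, (q i : ℝ≥0) ^ 2

/-- Stated additively because subtraction in `ℝ≥0` is truncated. -/
theorem energy_update (q : Fin N → ℕ) (i : Fin N) (n : ℕ) :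
    energy (Function.update q i n) + (q i : ℝ≥0) ^ 2 = energy q + (n : ℝ≥0) ^ 2 := by
  unfold energy
  rw [← Finset.add_sum_erase _ _ (Finset.mem_univ i),
    ← Finset.add_sum_erase (a := i) Finset.univ (fun j => (q j : ℝ≥0) ^ 2) (Finset.mem_univ i)]
  have : ∑ j ∈ Finset.univ.erase i, ((Function.update q i n j : ℕ) : ℝ≥0) ^ 2 =
      ∑ j ∈ Finset.univ.erase i, (q j : ℝ≥0) ^ 2 :=
    Finset.sum_congr rfl fun j hj => by rw [Function.update_of_ne (Finset.ne_of_mem_erase hj)]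
  rw [this, Function.update_self]
  ring

/-- Drift of the sum of the squares of the queue lengths. -/
theorem energy_drift (hN : 0 < N) {lam : ℝ≥0} (hlam1 : lam < 1) {T : ℝ} (hT : 0 ≤ T)
    {A : Fin N → Finset (Fin N)} (hA : ∀ h, (A h).Nonempty) (q : Fin N → ℕ) :
    ∑' q', ((chain N lam T A).rate q q' : ℝ≥0∞) * energy q' +
        ((2 * (1 - lam) * ∑ i, (q i : ℝ≥0) : ℝ≥0) : ℝ≥0∞) ≤
      (chain N lam T A).exitRate q * energy q + ((N * (1 + lam) : ℝ≥0) : ℝ≥0∞) := by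
  rw [tsum_rate_mul, exitRate_eq hN lam T hA, ← ENNReal.coe_add, ← ENNReal.coe_mul,
    ← ENNReal.coe_add, ENNReal.coe_le_coe, ← NNReal.coe_le_coe]
  have hp := congrArg NNReal.toReal (sum_joinProb hN T hA q)
  have hpq := NNReal.coe_le_coe.2 (sum_joinProb_mul_queue_le hN hT hA q)
  have hup : ∀ i, (energy (Function.update q i (q i + 1)) : ℝ) = energy q + 2 * q i + 1 := by
    intro i
    have := congrArg NNReal.toReal (energy_update q i (q i + 1))
    push_cast at this
    linarith
  -- An equality for a nonempty queue; for an empty one it reads 0 ≤ 1.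
  have hdown : ∀ i, ((if 0 < q i then energy (Function.update q i (q i - 1)) else 0 : ℝ≥0) : ℝ) ≤
      (if 0 < q i then 1 else 0) * (energy q : ℝ) - 2 * q i + 1 := by
    intro i
    split_ifs with h
    · obtain ⟨n, hn⟩ : ∃ n, q i = n + 1 := ⟨q i - 1, by omega⟩
      have hn' : (q i : ℝ) = n + 1 := by exact_mod_cast hn
      have := congrArg NNReal.toReal (energy_update q i n)
      push_cast at this
      rw [show q i - 1 = n by omega]
      rw [hn'] at this ⊢
      linarith
    · have h0 : q i = 0 := by omega
      simp [h0]
  have hsub : ((1 - lam : ℝ≥0) : ℝ) = 1 - lam := by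
    rw [NNReal.coe_sub hlam1.le]; simp
  push_cast [hsub] at hp hpq ⊢
  have h1 : ∑ i, (N : ℝ) * lam * joinProb T A q i * energy (Function.update q i (q i + 1)) =
      N * lam * (energy q + 1) + 2 * lam * (N * ∑ i, (joinProb T A q i : ℝ) * q i) := by
    simp_rw [hup]
    have : ∀ i, (N : ℝ) * lam * joinProb T A q i * (energy q + 2 * q i + 1) =
        N * lam * (energy q + 1) * joinProb T A q i +
          2 * lam * N * ((joinProb T A q i : ℝ) * q i) := fun i => by ring
    simp_rw [this]
    rw [Finset.sum_add_distrib, ← Finset.mul_sum, ← Finset.mul_sum, hp]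
    ring
  have h2 := Finset.sum_le_sum fun i (_ : i ∈ Finset.univ) => hdown i
  rw [Finset.sum_add_distrib, Finset.sum_sub_distrib, ← Finset.sum_mul, ← Finset.mul_sum] at h2
  simp only [Finset.sum_const, Finset.card_univ, Fintype.card_fin, nsmul_eq_mul, mul_one] at h2
  have h3 : 2 * (lam : ℝ) * (N * ∑ i, (joinProb T A q i : ℝ) * q i) ≤
      2 * lam * ∑ i, (q i : ℝ) := by gcongr
  have hite : ∀ i, ((if 0 < q i then 1 else 0 : ℝ≥0) : ℝ) = if 0 < q i then 1 else 0 := fun i => by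
    split_ifs <;> simp
  simp only [hite]
  rw [h1]
  nlinarith [h2, h3]

/-- A bound on the total confines every queue to a finite box. This is the compactness required by
Foster's criterion. -/
theorem finite_total_le {lam : ℝ≥0} (hlam1 : lam < 1) (R : ℝ≥0) :
    {q : Fin N → ℕ | 2 * (1 - lam) * ∑ i, (q i : ℝ≥0) ≤ R}.Finite := by
  have hpos : 0 < 2 * (1 - lam) := by
    have := tsub_pos_of_lt hlam1
    positivity
  refine (Set.finite_Icc (0 : Fin N → ℕ) (fun _ => ⌊R / (2 * (1 - lam))⌋₊)).subset fun q hq => ?_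
  refine ⟨fun i => Nat.zero_le _, fun i => Nat.le_floor ?_⟩
  rw [le_div_iff₀ hpos, mul_comm]
  refine le_trans ?_ hq
  gcongr
  exact Finset.single_le_sum (f := fun i => (q i : ℝ≥0)) (fun _ _ => zero_le) (Finset.mem_univ i)

/-! ### Communication between all states -/

theorem rate_departure_ne_zero (lam : ℝ≥0) (T : ℝ) (A : Fin N → Finset (Fin N)) {q : Fin N → ℕ}
    {i : Fin N} (hi : 0 < q i) :
    (chain N lam T A).rate q (Function.update q i (q i - 1)) ≠ 0 := by
  simp only [chain, rate, ne_eq, add_eq_zero, Finset.sum_eq_zero_iff, not_and_or]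
  right
  intro h
  have := h i (Finset.mem_univ i)
  simp [hi] at this

/-- A packet whose default queue is a shortest one is never redirected, since T ≥ 0. Longer queues
may receive no arrivals at all, so upward paths must go through shortest queues. -/
theorem joinProb_pos_of_minimal (hN : 0 < N) {T : ℝ} (hT : 0 ≤ T) {A : Fin N → Finset (Fin N)}
    (hA : ∀ h, (A h).Nonempty) {q : Fin N → ℕ} {i : Fin N} (hi : ∀ j, q i ≤ q j) :
    joinProb T A q i ≠ 0 := by
  have hroute : ∀ r, route T q i r = i := by
    intro r
    have h1 : (q i : ℝ) ≤ q r := by exact_mod_cast hi r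
    unfold route
    rw [if_neg]
    linarith
  intro h0
  rw [joinProb, Finset.sum_eq_zero_iff] at h0
  have := h0 i (Finset.mem_univ i)
  simp [hroute, hN.ne', (hA i).ne_empty] at this

theorem rate_arrival_ne_zero (hN : 0 < N) {lam : ℝ≥0} (hlam0 : 0 < lam) {T : ℝ} (hT : 0 ≤ T)
    {A : Fin N → Finset (Fin N)} (hA : ∀ h, (A h).Nonempty) {q : Fin N → ℕ} {i : Fin N}
    (hi : ∀ j, q i ≤ q j) :
    (chain N lam T A).rate q (Function.update q i (q i + 1)) ≠ 0 := by
  simp only [chain, rate, ne_eq, add_eq_zero, Finset.sum_eq_zero_iff, not_and_or]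
  left
  intro h
  have := h i (Finset.mem_univ i)
  simp [hN.ne', hlam0.ne', joinProb_pos_of_minimal hN hT hA hi] at this

theorem reaches_of_le (lam : ℝ≥0) (T : ℝ) (A : Fin N → Finset (Fin N)) {q y : Fin N → ℕ}
    (h : y ≤ q) :
    Relation.ReflTransGen (fun x z => (chain N lam T A).rate x z ≠ 0) q y := by
  induction hn : ∑ i, (q i - y i) generalizing q with
  | zero =>
    have : q = y := by
      ext i
      have h1 := Finset.sum_eq_zero_iff.1 hn i (Finset.mem_univ i)
      have h2 : y i ≤ q i := h i
      omega
    rw [this]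
  | succ n ih =>
    obtain ⟨i, hi⟩ : ∃ i, y i < q i := by
      by_contra! hc
      rw [Finset.sum_eq_zero fun i _ => by have := hc i; omega] at hn
      omega
    refine .head (rate_departure_ne_zero lam T A (q := q) (i := i) (by omega)) (ih ?_ ?_)
    · intro j
      by_cases hj : j = i
      · subst hj; simp; omega
      · simpa [hj] using h j
    · rw [← Finset.add_sum_erase _ _ (Finset.mem_univ i)] at hn ⊢
      rw [Finset.sum_congr rfl fun j hj => by
        rw [Function.update_of_ne (Finset.ne_of_mem_erase hj)], Function.update_self]
      omega

/-- Add packets to a shortest queue repeatedly; it stays below level m until all queues have reached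
m. -/
theorem reaches_const (hN : 0 < N) {lam : ℝ≥0} (hlam0 : 0 < lam) {T : ℝ} (hT : 0 ≤ T)
    {A : Fin N → Finset (Fin N)} (hA : ∀ h, (A h).Nonempty) {m : ℕ} {q : Fin N → ℕ}
    (h : ∀ i, q i ≤ m) :
    Relation.ReflTransGen (fun x z => (chain N lam T A).rate x z ≠ 0) q (fun _ => m) := by
  induction hn : ∑ i, (m - q i) generalizing q with
  | zero =>
    have : q = fun _ => m := by
      ext i
      have h1 := Finset.sum_eq_zero_iff.1 hn i (Finset.mem_univ i)
      have h2 := h i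
      omega
    rw [this]
  | succ n ih =>
    have : Nonempty (Fin N) := ⟨⟨0, hN⟩⟩
    obtain ⟨i, hi⟩ := Finite.exists_min q
    have him : q i < m := by
      by_contra! hc
      rw [Finset.sum_eq_zero fun j _ => by have := hc.trans (hi j); omega] at hn
      omega
    refine .head (rate_arrival_ne_zero hN hlam0 hT hA hi) (ih ?_ ?_)
    · intro j
      by_cases hj : j = i
      · subst hj; simp; omega
      · simpa [hj] using h j
    · rw [← Finset.add_sum_erase _ _ (Finset.mem_univ i)] at hn ⊢
      rw [Finset.sum_congr rfl fun j hj => by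
        rw [Function.update_of_ne (Finset.ne_of_mem_erase hj)], Function.update_self]
      omega

theorem reaches (hN : 0 < N) {lam : ℝ≥0} (hlam0 : 0 < lam) {T : ℝ} (hT : 0 ≤ T)
    {A : Fin N → Finset (Fin N)} (hA : ∀ h, (A h).Nonempty) (x y : Fin N → ℕ) :
    Relation.ReflTransGen (fun x z => (chain N lam T A).rate x z ≠ 0) x y := by
  have hb : ∀ i, x i ≤ ∑ j, (x j + y j) ∧ y i ≤ ∑ j, (x j + y j) := fun i => by
    have : x i + y i ≤ ∑ j, (x j + y j) :=
      Finset.single_le_sum (f := fun j => x j + y j) (fun _ _ => Nat.zero_le _)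
        (Finset.mem_univ i)
    omega
  exact (reaches_const hN hlam0 hT hA fun i => (hb i).1).trans
    (reaches_of_le lam T A fun i => (hb i).2)

end TTC
end

/-! ### The theorem -/

theorem theorem2 (N : ℕ) (hN : 0 < N) (lam : ℝ≥0) (hlam0 : 0 < lam) (hlam1 : lam < 1)
    (T : ℝ) (hT : 0 ≤ T) (A : Fin N → Finset (Fin N)) (hA : ∀ h, (A h).Nonempty) :
    (TTC.chain N lam T A).IsIrreducible ∧
      (TTC.chain N lam T A).IsNonexplosive ∧
      (TTC.chain N lam T A).IsPositiveRecurrent ∧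
      ∃ π : ProbabilityMeasure (Fin N → ℕ),
        (TTC.chain N lam T A).IsEquilibrium π ∧
        (∀ π', (TTC.chain N lam T A).IsEquilibrium π' → π' = π) ∧
        ∀ t : ℝ≥0,
          ∫⁻ ω, TTC.averageQueue ((TTC.chain N lam T A).state t ω)
              ∂((TTC.chain N lam T A).law (π : Measure (Fin N → ℕ))) <
            ENNReal.ofReal (1 / (1 - (lam : ℝ))) := by
  set Q := TTC.chain N lam T A with hQdef
  have hN' : (0 : ℝ≥0) < N := by exact_mod_cast hN
  have hq : ∀ x, Q.exitRate x ≠ 0 := TTC.exitRate_ne_zero hN hlam0 T hA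
  have hB : ∀ x, Q.exitRate x ≤ N * lam + N := TTC.exitRate_le hN lam T hA
  have hpos : ∀ x y, 0 < Q.trans 1 x y := fun x y =>
    Q.trans_pos hq (TTC.reaches hN hlam0 hT hA x y) 1 one_pos
  have hne : Q.IsNonexplosive := Q.isNonexplosive_of_exitRate_le hB
  obtain ⟨π, hbal, hmean⟩ := Q.exists_balance_of_drift (by positivity) hB (fun _ => 0)
    (TTC.energy_drift hN hlam1 hT hA) (TTC.finite_total_le hlam1)
  have heq : Q.IsEquilibrium π := Q.isEquilibrium_of_balance hq hB π hbal
  refine ⟨fun x y => ⟨1, hpos x y⟩, hne,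
    Q.isPositiveRecurrent_of_balance hq hne (RateMatrix.tsum_measure_singleton _) hbal
      (heq.singleton_pos hpos), π, heq, fun π' h' => heq.eq hne hpos h', fun t => ?_⟩
  rw [heq.lintegral_state hB]
  have hlam : 0 < 1 - lam := tsub_pos_of_lt hlam1
  have hc : 0 < 2 * (1 - lam) * N := by positivity
  -- The factor turns the average queue into the function 2(1-λ) Σ q_i whose mean Foster's criterion
  -- bounds.
  have hscale : ((2 * (1 - lam) * N : ℝ≥0) : ℝ≥0∞) *
      ∑' q, (π : Measure (Fin N → ℕ)) {q} * TTC.averageQueue (some q) ≤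
        ((N * (1 + lam) : ℝ≥0) : ℝ≥0∞) := by
    refine le_trans (le_of_eq ?_) hmean
    rw [← ENNReal.tsum_mul_left]
    refine tsum_congr fun q => ?_
    rw [mul_left_comm]
    congr 1
    have h1 : TTC.averageQueue (some q) = (((∑ i, (q i : ℝ≥0)) / N : ℝ≥0) : ℝ≥0∞) := by
      rw [TTC.averageQueue, ENNReal.coe_div hN'.ne']
      push_cast
      rfl
    rw [h1, ← ENNReal.coe_mul]
    congr 1
    field_simp
  have hle : ∑' q, (π : Measure (Fin N → ℕ)) {q} * TTC.averageQueue (some q) ≤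
      ((N * (1 + lam) / (2 * (1 - lam) * N) : ℝ≥0) : ℝ≥0∞) := by
    rw [ENNReal.coe_div hc.ne', ENNReal.le_div_iff_mul_le
      (Or.inl (ENNReal.coe_ne_zero.2 hc.ne')) (Or.inl ENNReal.coe_ne_top), mul_comm]
    exact hscale
  refine hle.trans_lt ?_
  rw [← ENNReal.ofReal_coe_nnreal]
  have hl : (lam : ℝ) < 1 := hlam1
  have hNr : (0 : ℝ) < N := by exact_mod_cast hN
  refine (ENNReal.ofReal_lt_ofReal_iff (by have : 0 < 1 - (lam : ℝ) := by linarith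
                                           positivity)).2 ?_
  rw [NNReal.coe_div, NNReal.coe_mul, NNReal.coe_mul, NNReal.coe_mul, NNReal.coe_sub hlam1.le]
  push_cast
  -- What remains is (1+λ)/(2(1-λ)) < 1/(1-λ), that is 1 + λ < 2.
  rw [div_lt_div_iff₀ (by have : 0 < 1 - (lam : ℝ) := by linarith
                          positivity) (by linarith)]
  nlinarith [mul_pos hNr (by linarith : 0 < 1 - (lam : ℝ))]
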